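/- **Setting.** Let $P_n$ (resp. $SP_n$) be the set of partitions (resp. strict partitions) of $n\ge 0$, $\ell(\lambda)$ the number of parts and $m_i(\lambda)$ the multiplicity of the part $i$ in $\lambda$. For $\lambda\in P_n$ let $\lambda^r$ be the strict partition with $m_i(\lambda^r)\in\{0,1\}$, $m_i(\lambda^r)\equiv m_i(\lambda) \pmod 2$, and let $\lambda^d$ be the partition with $m_i(\lambda^d)=\lfloor m_i(\lambda)/2\rfloor$. For $n_0+2n_1=n$ put $P_{n_0,n_1}=\{\lambda\in P_n:\lambda^r\in SP_{n_0},\ \lambda^d\in P_{n_1}\}$. For a strict partition $\mu$ let $\tilde\mu$ be the partition obtained by replacing every part $2^pq$ ($q$ odd) by $2^p$ parts equal to $q$. In $\mathbb C[t_1,t_2,\dots]$ let $S_\lambda(t)$ be the Schur function in the variables $t_j=p_j/j$, that is $S_\lambda(t)=\det(h_{\lambda_i-i+j})_{1\le i,j\le\ell(\lambda)}$ with $\sum_k h_kz^k=\exp\big(\sum_{j\ge1}t_jz^j\big)$ and $h_k=0$ for $k<0$. For a strict partition $\mu$ let $Q_\mu(t)$ be Schur's $Q$-function in the variables $t_j=2p_j/j$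 ($j$ odd), that is, with $\sum_k q_kz^k=\exp\big(\sum_{j\text{ odd}}t_jz^j\big)$ and $Q_{(a,b)}=q_aq_b+2\sum_{i=1}^{b}(-1)^iq_{a+i}q_{b-i}$ for $a>b\ge0$, $Q_\mu$ is the Pfaffian of the skew-symmetric matrix with entries $Q_{(\mu_i,\mu_j)}$ for $i<j$, where a part $0$ is appended to $\mu$ if $\ell(\mu)$ is odd. Let $f(t')$ denote $f(t)$ with every $t_j$ replaced by $t_{2j}$, and let $f^{(2)}$ denote $f$ with $t_2=t_4=\dots=0$. Put $W_\lambda(t)=Q_{\lambda^r}(t)\,S_{\lambda^d}(t')$. **Theorem 4.8.** Let $n\ge0$. There are unique complex matrices $A_n=(a_{\lambda\mu})_{\lambda,\mu\in P_n}$ and $\Gamma_n=(\gamma_{\lambda\mu})_{\lambda\in P_n,\,\mu\in SP_n}$ such that, for all $\lambda\in P_n$, $$S_\lambda(t)=\sum_{\mu\in P_n}a_{\lambda\mu}W_\mu(t),\qquad S^{(2)}_\lambda(t)=\sum_{\mu\in SP_n}\gamma_{\lambda\mu}Q_\mu(t).$$ The sets $P_{n_0,n_1}$ with $n_0+2n_1=n$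 partition $P_n$, and ${}^tA_nA_n$ is block diagonal with respect to this partition: its $(\lambda,\mu)$ entry is $0$ if $\lambda$ and $\mu$ lie in different sets $P_{n_0,n_1}$. Let $B_{n_0,n_1}$ be the diagonal block of ${}^tA_nA_n$ indexed by $P_{n_0,n_1}$. For all $n_0,n_1\ge 0$ with $n_0+2n_1=n$, $$|\det B_{n_0,n_1}|=2^{\sum_{\lambda\in P_{n_0,n_1}}(\ell(\widetilde{\lambda^r})+\ell(\lambda^d)-\ell(\lambda^r))}.$$ In particular $P_{n,0}=SP_n$, the principal block $B_{n,0}$ equals $G_n={}^t\Gamma_n\Gamma_n$, and $$\det G_n=2^{\sum_{\lambda\in SP_n}(\ell(\tilde\lambda)-\ell(\lambda))}.$$ -/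

import Mathlib

noncomputable section

namespace CompoundBasis

open MvPolynomial

/-! A partition of `n` is a `Nat.Partition n`. Functions that only need the parts take the multiset
of parts (a finite multiset of positive integers); its sum is the size of the partition and its
cardinality is the length. -/

/-! ### Combinatorics of partitions -/

/-- The strict partition `λʳ`: its parts are the `i` whose multiplicity in `λ` is odd. -/
def redParts (s : Multiset ℕ) : Multiset ℕ :=
  ∑ i ∈ s.toFinset, (s.count i % 2) • {i}

/-- The partition `λᵈ`: the multiplicity of `i` is `⌊m_i(λ) / 2⌋`. -/
def dblParts (s : Multiset ℕ) : Multiset ℕ :=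
  ∑ i ∈ s.toFinset, (s.count i / 2) • {i}

/-- The Glaisher map: every part `2 ^ p * q` with `q` odd is replaced by `2 ^ p` parts `q`. -/
def glaisher (s : Multiset ℕ) : Multiset ℕ :=
  s.bind fun a => Multiset.replicate (2 ^ padicValNat 2 a) (a / 2 ^ padicValNat 2 a)

/-- `P_{n₀,n₁}`, the partitions `λ` of `n` with `λʳ` a (strict) partition of `n₀` and `λᵈ` a
partition of `n₁`. -/
def blockIndex (n n₀ n₁ : ℕ) : Finset n.Partition :=
  Finset.univ.filter fun p => (redParts p.parts).sum = n₀ ∧ (dblParts p.parts).sum = n₁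

/-! ### Schur functions and Schur `Q`-functions in the time variables `t₁, t₂, …` -/

/-- The ring `ℂ[t_j ; j ≥ 1]`. -/
abbrev TimeRing : Type := MvPolynomial ℕ+ ℂ

/-- The monomial `t₁^{m₁} t₂^{m₂} ⋯ / (m₁! m₂! ⋯)` of the partition `ρ = (1^{m₁} 2^{m₂} ⋯)`. -/
def timeMonomial {n : ℕ} (ρ : n.Partition) : TimeRing :=
  ∏ i ∈ ρ.parts.toFinset,
    C ((Nat.factorial (ρ.parts.count i) : ℂ)⁻¹) * X (Nat.toPNat' i) ^ ρ.parts.count i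

/-- The complete symmetric function `h_k`: `∑ h_k z^k = exp (∑_{j ≥ 1} t_j z^j)`. -/
def completeH (k : ℕ) : TimeRing := ∑ ρ : k.Partition, timeMonomial ρ

/-- `h_k` for an integer `k`, zero for negative `k`. -/
def completeHInt (k : ℤ) : TimeRing := if 0 ≤ k then completeH k.toNat else 0

/-- The parts in weakly decreasing order. -/
def sortedParts (s : Multiset ℕ) : List ℕ := s.sort (fun a b => a ≥ b)

/-- The `i`-th part (counted from `0`), which is `0` beyond the length. -/
def part (s : Multiset ℕ) (i : ℕ) : ℕ := (sortedParts s).getD i 0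

/-- The Schur function `S_λ(t) = det (h_{λ_i - i + j})`, of size the length of `λ`. -/
def schurS (s : Multiset ℕ) : TimeRing :=
  Matrix.det (Matrix.of fun i j : Fin s.card =>
    completeHInt ((part s i : ℤ) - (i : ℤ) + (j : ℤ)))

/-- `q_k`: `∑ q_k z^k = exp (∑_{j odd} t_j z^j)`, which is `∏ (1 + x_i z) / (1 - x_i z)` for
`t_j = 2 p_j(x) / j`. -/
def littleQ (k : ℕ) : TimeRing := ∑ ρ ∈ Nat.Partition.odds k, timeMonomial ρ

/-- `Q_{(a,b)} = q_a q_b + 2 ∑_{i=1}^{b} (-1)^i q_{a+i} q_{b-i}` for `a > b ≥ 0`. -/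
def twoRowQ (a b : ℕ) : TimeRing :=
  littleQ a * littleQ b +
    2 * ∑ i ∈ Finset.Icc 1 b, (-1) ^ i * (littleQ (a + i) * littleQ (b - i))

/-- The Pfaffian of a skew-symmetric matrix, by expansion along the first row (it is `0` in odd
size). -/
def pfaffian {R : Type*} [CommRing R] : (k : ℕ) → Matrix (Fin k) (Fin k) R → R
  | 0, _ => 1
  | 1, _ => 0
  | k + 2, A => ∑ j : Fin (k + 1), (-1) ^ (j : ℕ) * A 0 j.succ *
      pfaffian k (A.submatrix (fun i => (j.succAbove i).succ) (fun i => (j.succAbove i).succ))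

/-- Schur's `Q`-function `Q_λ(t)` of a strict partition `λ`: the Pfaffian of the skew-symmetric
matrix with entries `Q_{(λ_i, λ_j)}` for `i < j`, where a part `0` is added if the length is odd. -/
def schurQ (s : Multiset ℕ) : TimeRing :=
  pfaffian (s.card + s.card % 2) (Matrix.of fun i j =>
    if i < j then twoRowQ (part s i) (part s j)
    else if j < i then -twoRowQ (part s j) (part s i) else 0)

/-- The substitution `f(t) ↦ f(t')`, that is `t_j ↦ t_{2j}`. -/
def doubleTime : TimeRing →ₐ[ℂ] TimeRing := rename fun j => 2 * j

/-- The 2-reduction `f ↦ f⁽²⁾`, that is `t_2 = t_4 = ⋯ = 0`. -/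
def twoReduction : TimeRing →ₐ[ℂ] TimeRing :=
  aeval fun j : ℕ+ => if Even (j : ℕ) then 0 else X j

/-- The compound basis element `W_λ(t) = Q_{λʳ}(t) S_{λᵈ}(t')`. -/
def compoundW (s : Multiset ℕ) : TimeRing :=
  schurQ (redParts s) * doubleTime (schurS (dblParts s))

/-! ### The matrices -/

/-- `A` is the transition matrix `A_n`: `S_λ = ∑_μ a_{λμ} W_μ` for all partitions `λ` of `n`. -/
def IsTransitionMatrix (n : ℕ) (A : Matrix n.Partition n.Partition ℂ) : Prop :=
  ∀ p : n.Partition, schurS p.parts = ∑ r : n.Partition, A p r • compoundW r.parts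

/-- `Γ` is the matrix `Γ_n` of Stembridge coefficients:
`S_λ⁽²⁾ = ∑_{μ strict} γ_{λμ} Q_μ` for all partitions `λ` of `n`. -/
def IsStembridgeMatrix (n : ℕ)
    (Γ : Matrix n.Partition (Nat.Partition.distincts n) ℂ) : Prop :=
  ∀ p : n.Partition, twoReduction (schurS p.parts) =
    ∑ r : Nat.Partition.distincts n, Γ p r • schurQ r.1.parts

/-- The diagonal block `B_{n₀,n₁}` of `ᵗA A`. -/
def block {n : ℕ} (A : Matrix n.Partition n.Partition ℂ) (n₀ n₁ : ℕ) :
    Matrix (blockIndex n n₀ n₁) (blockIndex n n₀ n₁) ℂ :=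
  (A.transpose * A).submatrix Subtype.val Subtype.val

/-- `P_{n,0}` is the set of strict partitions of `n`. -/
theorem blockIndex_principal (n : ℕ) : blockIndex n n 0 = Nat.Partition.distincts n := by
  ext p
  simp only [blockIndex, Nat.Partition.distincts, Finset.mem_filter, Finset.mem_univ, true_and]
  constructor
  · rintro ⟨-, h⟩
    rw [Multiset.nodup_iff_count_le_one]
    intro a
    by_cases ha : a ∈ p.parts
    · have hpos := p.parts_pos ha
      rw [dblParts, Multiset.sum_sum, Finset.sum_eq_zero_iff] at h
      have := h a (by simpa using ha)
      simp only [Multiset.sum_nsmul, Multiset.sum_singleton, smul_eq_mul, mul_eq_zero] at this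
      omega
    · simp [Multiset.count_eq_zero_of_notMem ha]
  · intro h
    have hc : ∀ a ∈ p.parts.toFinset, p.parts.count a = 1 := fun a ha =>
      Multiset.count_eq_one_of_mem h (by simpa using ha)
    constructor
    · have : redParts p.parts = p.parts := by
        conv_rhs => rw [← Multiset.toFinset_sum_count_nsmul_eq p.parts]
        exact Finset.sum_congr rfl fun a ha => by rw [hc a ha]
      rw [this, p.parts_sum]
    · have : dblParts p.parts = 0 :=
        Finset.sum_eq_zero fun a ha => by rw [hc a ha]; simp
      rw [this, Multiset.sum_zero]

/-- The identification of the index set of the principal block with the strict partitions. -/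
def principalEquiv (n : ℕ) : blockIndex n n 0 ≃ Nat.Partition.distincts n :=
  Equiv.subtypeEquivRight fun p => by rw [blockIndex_principal]

end CompoundBasis

end

open CompoundBasis

noncomputable section

namespace CompoundBasis

open MvPolynomial

/-! ### Exponent vectors of partitions -/

/-- The exponent vector of the monomial attached to a multiset of parts. -/
def exponent (s : Multiset ℕ) : ℕ+ →₀ ℕ :=
  Finsupp.comapDomain PNat.val (Multiset.toFinsupp s) PNat.coe_injective.injOn

@[simp] theorem exponent_apply (s : Multiset ℕ) (i : ℕ+) : exponent s i = s.count (i : ℕ) := by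
  simp [exponent]

/-- The weight of an exponent vector, with `t_j` of weight `j`. -/
def expWeight (m : ℕ+ →₀ ℕ) : ℕ := m.sum fun j k => k * (j : ℕ)

theorem expWeight_add (m m' : ℕ+ →₀ ℕ) : expWeight (m + m') = expWeight m + expWeight m' := by
  unfold expWeight
  rw [Finsupp.sum_add_index'] <;> simp [add_mul]

@[simp] theorem expWeight_single (j : ℕ+) (k : ℕ) :
    expWeight (Finsupp.single j k) = k * (j : ℕ) := by
  simp [expWeight]

/-- The multiset of parts with a given exponent vector. -/
def expParts (m : ℕ+ →₀ ℕ) : Multiset ℕ := (Finsupp.toMultiset m).map PNat.val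

theorem count_expParts (m : ℕ+ →₀ ℕ) (i : ℕ+) : (expParts m).count (i : ℕ) = m i := by
  rw [expParts, Multiset.count_map_eq_count' _ _ PNat.coe_injective, Finsupp.count_toMultiset]

theorem exponent_expParts (m : ℕ+ →₀ ℕ) : exponent (expParts m) = m := by
  ext i
  rw [exponent_apply, count_expParts]

theorem pos_of_mem_expParts {m : ℕ+ →₀ ℕ} {i : ℕ} (h : i ∈ expParts m) : 0 < i := by
  obtain ⟨j, -, rfl⟩ := Multiset.mem_map.1 h
  exact j.pos

theorem sum_expParts (m : ℕ+ →₀ ℕ) : (expParts m).sum = expWeight m := by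
  rw [expParts, Finsupp.toMultiset_map, Finsupp.toMultiset_apply,
    Finsupp.sum_mapDomain_index (by simp) (by simp [add_smul])]
  simp [Finsupp.sum, expWeight, Multiset.sum_sum, Multiset.sum_nsmul]

theorem expParts_exponent {s : Multiset ℕ} (hs : ∀ i ∈ s, 0 < i) : expParts (exponent s) = s := by
  ext i
  rcases Nat.eq_zero_or_pos i with rfl | hi
  · rw [Multiset.count_eq_zero_of_notMem, Multiset.count_eq_zero_of_notMem]
    · exact fun h => (hs 0 h).false
    · exact fun h => (pos_of_mem_expParts h).false
  · lift i to ℕ+ using hi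
    rw [count_expParts, exponent_apply]

theorem expWeight_exponent {s : Multiset ℕ} (hs : ∀ i ∈ s, 0 < i) :
    expWeight (exponent s) = s.sum := by
  rw [← sum_expParts, expParts_exponent hs]

/-- Partitions of `n` correspond to exponent vectors of weight `n`. -/
def partitionEquiv (n : ℕ) : n.Partition ≃ {m : ℕ+ →₀ ℕ // expWeight m = n} where
  toFun ρ := ⟨exponent ρ.parts, by rw [expWeight_exponent fun _ => ρ.parts_pos, ρ.parts_sum]⟩
  invFun m := ⟨expParts m.1, pos_of_mem_expParts, by rw [sum_expParts, m.2]⟩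
  left_inv ρ := Nat.Partition.ext (expParts_exponent fun _ => ρ.parts_pos)
  right_inv m := Subtype.ext (exponent_expParts m.1)

theorem exponent_injective {n : ℕ} {ρ σ : n.Partition}
    (h : exponent ρ.parts = exponent σ.parts) : ρ = σ :=
  (partitionEquiv n).injective (Subtype.ext h)

/-- The product of the factorials of the entries. -/
def expFactorial (m : ℕ+ →₀ ℕ) : ℂ := m.prod fun _ k => (k.factorial : ℂ)

theorem expFactorial_ne_zero (m : ℕ+ →₀ ℕ) : expFactorial m ≠ 0 :=
  Finset.prod_ne_zero_iff.2 fun _ _ => Nat.cast_ne_zero.2 (Nat.factorial_ne_zero _)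

theorem expFactorial_add_single (m : ℕ+ →₀ ℕ) (j : ℕ+) :
    expFactorial (m + Finsupp.single j 1) = (m j + 1) * expFactorial m := by
  unfold expFactorial
  rw [← Finsupp.mul_prod_erase' (m + Finsupp.single j 1) j _ (by simp),
    ← Finsupp.mul_prod_erase' m j _ (by simp), Finsupp.erase_add, Finsupp.erase_single, add_zero]
  simp [Nat.factorial_succ]
  ring

theorem timeMonomial_eq {n : ℕ} (ρ : n.Partition) :
    timeMonomial ρ = monomial (exponent ρ.parts) (expFactorial (exponent ρ.parts))⁻¹ := by
  have h : ρ.parts.toFinset = (exponent ρ.parts).support.map ⟨PNat.val, PNat.coe_injective⟩ := by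
    ext i
    simp only [Multiset.mem_toFinset, Finset.mem_map, Finsupp.mem_support_iff, exponent_apply,
      Function.Embedding.coeFn_mk, ne_eq, Multiset.count_eq_zero, not_not]
    exact ⟨fun hi => ⟨⟨i, ρ.parts_pos hi⟩, hi, rfl⟩, by rintro ⟨j, hj, rfl⟩; exact hj⟩
  rw [monomial_eq, timeMonomial, h, Finset.prod_map, Finset.prod_mul_distrib, expFactorial,
    Finsupp.prod, Finsupp.prod, ← Finset.prod_inv_distrib, map_prod]
  have (x : ℕ+) : Nat.toPNat' (x : ℕ) = x := PNat.coe_toPNat' x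
  simp [this]

theorem coeff_completeH (k : ℕ) (m : ℕ+ →₀ ℕ) :
    coeff m (completeH k) = if expWeight m = k then (expFactorial m)⁻¹ else 0 := by
  simp only [completeH, timeMonomial_eq, coeff_sum, coeff_monomial]
  split_ifs with h
  · obtain ⟨ρ, hρ⟩ := (partitionEquiv k).surjective ⟨m, h⟩
    have hm : exponent ρ.parts = m := congrArg Subtype.val hρ
    rw [Finset.sum_eq_single ρ, if_pos hm, hm]
    · exact fun σ _ hσ => if_neg fun h' => hσ (exponent_injective (h'.trans hm.symm))
    · simp
  · refine Finset.sum_eq_zero fun ρ _ => if_neg ?_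
    rintro rfl
    exact h (partitionEquiv k ρ).2

theorem completeH_zero : completeH 0 = 1 := by
  ext m
  rw [coeff_completeH, coeff_one]
  have : expWeight m = 0 ↔ 0 = m := by
    constructor
    · intro h
      ext j
      by_contra hj
      have := (Finset.sum_eq_zero_iff.1 h) j (Finsupp.mem_support_iff.2 (Ne.symm hj))
      have := j.pos
      simp_all
    · rintro rfl; simp [expWeight]
  simp only [this]
  split_ifs with h
  · simp [← h, expFactorial]
  · rfl

/-- The time variable `t_j`, zero for `j = 0`. -/
def timeVar (j : ℕ) : TimeRing := if 0 < j then X (Nat.toPNat' j) else 0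

@[simp] theorem timeVar_zero : timeVar 0 = 0 := rfl

@[simp] theorem timeVar_coe (j : ℕ+) : timeVar j = X j := by
  simp [timeVar, PNat.coe_toPNat']

/-- Newton's identity for the complete symmetric functions. -/
theorem newton_completeH (k : ℕ) : (k : TimeRing) * completeH k =
    ∑ x ∈ Finset.HasAntidiagonal.antidiagonal k, ((x.1 : TimeRing) * timeVar x.1) * completeH x.2 := by
  ext m
  have hc (c : ℕ) (f : TimeRing) : coeff m ((c : TimeRing) * f) = c * coeff m f := by
    rw [← map_natCast (C (σ := ℕ+) (R := ℂ)), coeff_C_mul]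
  rw [hc, coeff_sum]
  have hterm : ∀ x ∈ Finset.HasAntidiagonal.antidiagonal k,
      coeff m (((x.1 : TimeRing) * timeVar x.1) * completeH x.2) =
      if expWeight m = k then (x.1 : ℂ) * (expParts m).count x.1 * (expFactorial m)⁻¹ else 0 := by
    rintro ⟨i, l⟩ hx
    rw [Finset.HasAntidiagonal.mem_antidiagonal] at hx
    simp only at hx ⊢
    rw [mul_assoc, hc]
    rcases Nat.eq_zero_or_pos i with rfl | hi
    · simp
    · lift i to ℕ+ using hi
      rw [timeVar_coe, coeff_X_mul', coeff_completeH]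
      have hcount := count_expParts m i
      by_cases hm : m i = 0
      · simp [hm, hcount]
      · have hs : m = (m - Finsupp.single i 1) + Finsupp.single i 1 := by
          rw [tsub_add_cancel_of_le]
          rw [Finsupp.single_le_iff]; omega
        set m' := m - Finsupp.single i 1 with hm'
        have hw : expWeight m = expWeight m' + i := by
          conv_lhs => rw [hs]
          simp [expWeight_add]
        rw [if_pos (by simpa using hm), hw]
        have : expWeight m' = l ↔ expWeight m' + i = k := by omega
        simp only [this]
        split_ifs with h
        · rw [hcount, hs, expFactorial_add_single]
          simp only [Finsupp.add_apply, Finsupp.single_eq_same]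
          have h1 := expFactorial_ne_zero m'
          have h2 : (m' i : ℂ) + 1 ≠ 0 := Nat.cast_add_one_ne_zero _
          push_cast
          field_simp
        · simp
  rw [Finset.sum_congr rfl hterm, coeff_completeH]
  split_ifs with h
  · rw [← Finset.sum_mul]
    congr 1
    have : k = ∑ i ∈ Finset.range (k + 1), (expParts m).count i * i := by
      conv_lhs => rw [← h, ← sum_expParts]
      rw [Finset.sum_multiset_count]
      refine Finset.sum_subset (fun i hi => ?_) fun i _ hi => ?_
      · rw [Finset.mem_range, Nat.lt_succ_iff, ← h, ← sum_expParts]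
        exact Multiset.single_le_sum (fun _ _ => Nat.zero_le _) _ (Multiset.mem_toFinset.1 hi)
      · rw [Multiset.count_eq_zero_of_notMem (by simpa using hi), zero_smul]
    rw [Finset.Nat.sum_antidiagonal_eq_sum_range_succ_mk]
    conv_lhs => rw [this]
    push_cast
    exact Finset.sum_congr rfl fun i _ => by ring
  · simp

/-! ### The odd reduction -/

theorem twoReduction_X (j : ℕ+) :
    twoReduction (X j) = if Even (j : ℕ) then 0 else X j := by
  simp [twoReduction]

theorem twoReduction_timeVar (j : ℕ) :
    twoReduction (timeVar j) = if Even j then 0 else timeVar j := by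
  rcases Nat.eq_zero_or_pos j with rfl | hj
  · simp
  · lift j to ℕ+ using hj
    rw [timeVar_coe, twoReduction_X]

theorem littleQ_eq (k : ℕ) : littleQ k = twoReduction (completeH k) := by
  rw [littleQ, completeH, map_sum, Nat.Partition.odds, Nat.Partition.restricted, Finset.sum_filter]
  refine Finset.sum_congr rfl fun ρ _ => ?_
  rw [timeMonomial, map_prod]
  split_ifs with h
  · refine Finset.prod_congr rfl fun i hi => ?_
    have hi' := Multiset.mem_toFinset.1 hi
    have := h i hi'
    rw [map_mul, map_pow, twoReduction_X, algHom_C, algebraMap_eq,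
      Nat.toPNat'_coe, if_pos (ρ.parts_pos hi'), if_neg this]
  · push Not at h
    obtain ⟨i, hi, he⟩ := h
    refine (Finset.prod_eq_zero (Multiset.mem_toFinset.2 hi) ?_).symm
    rw [map_mul, map_pow, twoReduction_X, Nat.toPNat'_coe, if_pos (ρ.parts_pos hi), if_pos he,
      zero_pow (Multiset.count_ne_zero.2 hi), mul_zero]

theorem littleQ_zero : littleQ 0 = 1 := by
  rw [littleQ_eq, completeH_zero, map_one]

/-- The odd time variables; zero for even `j`. -/
def oddVar (j : ℕ) : TimeRing := if Even j then 0 else timeVar j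

theorem newton_littleQ (k : ℕ) : (k : TimeRing) * littleQ k =
    ∑ x ∈ Finset.HasAntidiagonal.antidiagonal k, ((x.1 : TimeRing) * oddVar x.1) * littleQ x.2 := by
  have := congrArg twoReduction (newton_completeH k)
  simpa [littleQ_eq, oddVar, twoReduction_timeVar] using this

theorem twoReduction_littleQ (k : ℕ) : twoReduction (littleQ k) = littleQ k := by
  rw [littleQ_eq, twoReduction, ← AlgHom.comp_apply]
  congr 1
  ext1 j
  simp only [AlgHom.comp_apply, aeval_X]
  split_ifs with h <;> simp [h]

/-! ### The bilinear forms -/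

/-- The squared norm of the monomial with exponent vector `m` in the form with parameters `c`. -/
def expNorm (c : ℕ+ → ℂ) (m : ℕ+ →₀ ℕ) : ℂ := m.prod fun j k => (k.factorial : ℂ) * c j ^ k

/-- The bilinear form for which the monomials are orthogonal and `t_j` is adjoint to
`c_j ∂ / ∂ t_j`. -/
def form (c : ℕ+ → ℂ) : TimeRing →ₗ[ℂ] TimeRing →ₗ[ℂ] ℂ :=
  (basisMonomials ℕ+ ℂ).constr ℂ fun m => expNorm c m • lcoeff ℂ m

theorem form_monomial (c : ℕ+ → ℂ) (m : ℕ+ →₀ ℕ) (a : ℂ) (g : TimeRing) :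
    form c (monomial m a) g = a * expNorm c m * coeff m g := by
  have h : monomial m a = a • basisMonomials ℕ+ ℂ m := by
    rw [coe_basisMonomials, smul_monomial, smul_eq_mul, mul_one]
  rw [h, map_smul, form, Module.Basis.constr_basis]
  simp [lcoeff, mul_assoc]

theorem form_symm (c : ℕ+ → ℂ) (f g : TimeRing) : form c f g = form c g f := by
  suffices form c = (form c).flip from congrArg (fun F => F f g) this
  refine (basisMonomials ℕ+ ℂ).ext fun m => (basisMonomials ℕ+ ℂ).ext fun m' => ?_
  simp only [coe_basisMonomials, LinearMap.flip_apply, form_monomial, coeff_monomial]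
  by_cases h : m = m'
  · simp [h]
  · simp [h, Ne.symm h]

theorem expNorm_add_single (c : ℕ+ → ℂ) (m : ℕ+ →₀ ℕ) (j : ℕ+) :
    expNorm c (m + Finsupp.single j 1) = (m j + 1) * c j * expNorm c m := by
  unfold expNorm
  rw [← Finsupp.mul_prod_erase' (m + Finsupp.single j 1) j _ (by simp),
    ← Finsupp.mul_prod_erase' m j _ (by simp), Finsupp.erase_add, Finsupp.erase_single, add_zero]
  simp [Nat.factorial_succ]
  ring

theorem form_X_mul (c : ℕ+ → ℂ) (j : ℕ+) (f g : TimeRing) :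
    form c (X j * f) g = c j * form c f (pderiv j g) := by
  induction f using MvPolynomial.induction_on' with
  | monomial u a =>
    rw [X, monomial_mul, form_monomial, form_monomial, coeff_pderiv, add_comm,
      expNorm_add_single]
    ring
  | add p q hp hq => simp only [mul_add, map_add, LinearMap.add_apply, hp, hq]

theorem form_mul_X (c : ℕ+ → ℂ) (j : ℕ+) (f g : TimeRing) :
    form c f (X j * g) = c j * form c (pderiv j f) g := by
  rw [form_symm, form_X_mul, form_symm]

theorem form_one_left (c : ℕ+ → ℂ) (g : TimeRing) : form c 1 g = constantCoeff g := by
  have : (1 : TimeRing) = monomial 0 1 := rfl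
  rw [this, form_monomial]
  simp [expNorm, constantCoeff_eq]

/-! ### Shifts of the time variables -/

/-- The substitution `t_j ↦ t_j + c_j z ^ j`. -/
def shift (c : ℕ+ → ℂ) : TimeRing →ₐ[ℂ] Polynomial TimeRing :=
  aeval fun j => Polynomial.C (X j) + Polynomial.C (C (c j)) * Polynomial.X ^ (j : ℕ)

theorem shift_X (c : ℕ+ → ℂ) (j : ℕ+) :
    shift c (X j) = Polynomial.C (X j) + Polynomial.C (C (c j)) * Polynomial.X ^ (j : ℕ) := by
  simp [shift]

/-- The coefficient of `z ^ m` after the substitution `t_j ↦ t_j + c_j z ^ j`. -/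
def skew (c : ℕ+ → ℂ) (m : ℕ) : TimeRing →ₗ[ℂ] TimeRing where
  toFun v := (shift c v).coeff m
  map_add' := by simp
  map_smul' := by simp

theorem skew_apply (c : ℕ+ → ℂ) (m : ℕ) (v : TimeRing) : skew c m v = (shift c v).coeff m := rfl

theorem skew_one (c : ℕ+ → ℂ) (m : ℕ) : skew c m 1 = if m = 0 then 1 else 0 := by
  rw [skew_apply, map_one, Polynomial.coeff_one]

theorem skew_C (c : ℕ+ → ℂ) (m : ℕ) (a : ℂ) : skew c m (C a) = if m = 0 then C a else 0 := by
  have : (C a : TimeRing) = a • 1 := by rw [smul_eq_C_mul, mul_one]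
  rw [this, map_smul, skew_one]
  split_ifs <;> simp

theorem skew_X_mul (c : ℕ+ → ℂ) (m : ℕ) (j : ℕ+) (v : TimeRing) :
    skew c m (X j * v) = X j * skew c m v +
      if (j : ℕ) ≤ m then C (c j) * skew c (m - j) v else 0 := by
  simp only [skew_apply, map_mul, shift_X, add_mul, Polynomial.coeff_add, Polynomial.coeff_C_mul,
    mul_assoc, Polynomial.coeff_X_pow_mul']
  split_ifs <;> simp

/-- Multiplication by `h_k` is adjoint to the coefficient of `z ^ k` of a shift, when
`∂_j h_k = s_j h_{k - j}`. -/
theorem form_mul_skew {c s : ℕ+ → ℂ} {h : ℕ → TimeRing} (h0 : h 0 = 1)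
    (hc : ∀ k, k ≠ 0 → constantCoeff (h k) = 0)
    (hd : ∀ j k, pderiv j (h k) = if (j : ℕ) ≤ k then C (s j) * h (k - j) else 0)
    (k : ℕ) (f g : TimeRing) :
    form c (h k * f) g = form c f (skew (fun j => s j * c j) k g) := by
  induction g using MvPolynomial.induction_on generalizing k f with
  | C a =>
    rw [skew_C]
    split_ifs with hk
    · rw [hk, h0, one_mul]
    · have : (C a : TimeRing) = a • 1 := by rw [smul_eq_C_mul, mul_one]
      rw [this, form_symm, map_smul, LinearMap.smul_apply, form_one_left, map_mul, hc k hk]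
      simp
  | add p q hp hq => simp only [map_add, hp, hq]
  | mul_X p j hp =>
    rw [mul_comm p, skew_X_mul, form_mul_X, Derivation.leibniz, map_add, hd, map_add, form_mul_X]
    simp only [smul_eq_mul]
    rw [LinearMap.add_apply, hp, mul_add]
    congr 1
    split_ifs with hj
    · rw [mul_left_comm, ← smul_eq_C_mul, map_smul, LinearMap.smul_apply, mul_comm f, hp,
        ← smul_eq_C_mul, map_smul]
      simp only [smul_eq_mul]
      ring
    · simp

/-! ### Derivatives of the one-row functions -/

theorem pderiv_completeH (j : ℕ+) (k : ℕ) :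
    pderiv j (completeH k) = if (j : ℕ) ≤ k then C 1 * completeH (k - j) else 0 := by
  ext m
  rw [coeff_pderiv, coeff_completeH, expFactorial_add_single, expWeight_add, expWeight_single]
  have h1 := expFactorial_ne_zero m
  have h2 : (m j : ℂ) + 1 ≠ 0 := Nat.cast_add_one_ne_zero _
  split_ifs with h3 h4 h4
  · rw [C_1, one_mul, coeff_completeH, if_pos (by omega)]
    field_simp
  · omega
  · rw [C_1, one_mul, coeff_completeH, if_neg (by omega), zero_mul]
  · simp

theorem pderiv_twoReduction (j : ℕ+) (f : TimeRing) :
    pderiv j (twoReduction f) = if Even (j : ℕ) then 0 else twoReduction (pderiv j f) := by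
  induction f using MvPolynomial.induction_on with
  | C a => simp [twoReduction]
  | add p q hp hq =>
    rw [map_add, map_add, hp, hq]
    split_ifs <;> simp
  | mul_X p i hp =>
    rw [map_mul, Derivation.leibniz, hp, twoReduction_X, Derivation.leibniz]
    simp only [smul_eq_mul, pderiv_X, map_add, map_mul, twoReduction_X]
    by_cases hij : i = j
    · subst hij
      split_ifs <;> simp
    · simp only [Pi.single_eq_of_ne hij, mul_zero, map_zero, zero_add]
      split_ifs <;> simp [hij]

theorem pderiv_littleQ (j : ℕ+) (k : ℕ) : pderiv j (littleQ k) =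
    if (j : ℕ) ≤ k then C (if Even (j : ℕ) then 0 else 1) * littleQ (k - j) else 0 := by
  rw [littleQ_eq, pderiv_twoReduction, pderiv_completeH]
  split_ifs <;> simp [littleQ_eq]

theorem constantCoeff_completeH {k : ℕ} (hk : k ≠ 0) : constantCoeff (completeH k) = 0 := by
  rw [constantCoeff_eq, coeff_completeH, if_neg]
  simpa [expWeight] using hk.symm

theorem constantCoeff_twoReduction (f : TimeRing) :
    constantCoeff (twoReduction f) = constantCoeff f := by
  induction f using MvPolynomial.induction_on with
  | C a => simp [twoReduction]
  | add p q hp hq => simp [hp, hq]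
  | mul_X p i hp =>
    rw [map_mul, map_mul, twoReduction_X]
    split_ifs <;> simp

theorem constantCoeff_littleQ {k : ℕ} (hk : k ≠ 0) : constantCoeff (littleQ k) = 0 := by
  rw [littleQ_eq, constantCoeff_twoReduction, constantCoeff_completeH hk]

/-- Parameters of the Hall form. -/
def hallParam (j : ℕ+) : ℂ := 1 / (j : ℂ)

/-- Parameters of the form for which the `Q`-functions are orthogonal. -/
def qParam (j : ℕ+) : ℂ := 2 / (j : ℂ)

/-- Parameters of the shift adjoint to the multiplication by `q_k`. -/
def qShift (j : ℕ+) : ℂ := (if Even (j : ℕ) then 0 else 1) * qParam j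

theorem form_completeH_mul (k : ℕ) (f g : TimeRing) :
    form hallParam (completeH k * f) g = form hallParam f (skew hallParam k g) := by
  have := form_mul_skew (c := hallParam) (s := fun _ => 1) completeH_zero
    (fun k => constantCoeff_completeH) pderiv_completeH k f g
  simpa using this

theorem form_littleQ_mul (k : ℕ) (f g : TimeRing) :
    form qParam (littleQ k * f) g = form qParam f (skew qShift k g) :=
  form_mul_skew littleQ_zero (fun _ => constantCoeff_littleQ) pderiv_littleQ k f g

/-! ### Logarithmic derivatives of power series -/

section LogDeriv

variable {A B : Type*} [CommRing A] [CommRing B]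

/-- `H` is the solution with constant term `1` of `z H' = P H`. -/
def HasLogDeriv (P H : PowerSeries A) : Prop :=
  PowerSeries.constantCoeff H = 1 ∧ PowerSeries.X * PowerSeries.derivative A H = P * H

theorem coeff_X_mul_derivative (H : PowerSeries A) (k : ℕ) :
    PowerSeries.coeff k (PowerSeries.X * PowerSeries.derivative A H) =
      k * PowerSeries.coeff k H := by
  cases k with
  | zero => simp
  | succ k =>
    rw [PowerSeries.coeff_succ_X_mul, PowerSeries.coeff_derivative, mul_comm]
    push_cast; ring

theorem HasLogDeriv.mul {P P' H H' : PowerSeries A} (h : HasLogDeriv P H)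
    (h' : HasLogDeriv P' H') : HasLogDeriv (P + P') (H * H') := by
  refine ⟨by rw [map_mul, h.1, h'.1, one_mul], ?_⟩
  rw [Derivation.leibniz, smul_eq_mul, smul_eq_mul]
  linear_combination H * h'.2 + H' * h.2

theorem HasLogDeriv.unique [IsDomain A] [CharZero A] {P H H' : PowerSeries A}
    (h : HasLogDeriv P H) (h' : HasLogDeriv P H') : H = H' := by
  have hP : PowerSeries.coeff 0 P = 0 := by
    have := congrArg PowerSeries.constantCoeff h.2
    rw [map_mul, map_mul, h.1] at this
    simpa using this.symm
  ext k
  induction k using Nat.strong_induction_on with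
  | _ k ih =>
    rcases Nat.eq_zero_or_pos k with rfl | hk
    · rw [PowerSeries.coeff_zero_eq_constantCoeff_apply,
        PowerSeries.coeff_zero_eq_constantCoeff_apply, h.1, h'.1]
    · have e : (k : A) * PowerSeries.coeff k H = k * PowerSeries.coeff k H' := by
        rw [← coeff_X_mul_derivative, ← coeff_X_mul_derivative, h.2, h'.2,
          PowerSeries.coeff_mul, PowerSeries.coeff_mul]
        refine Finset.sum_congr rfl fun x hx => ?_
        rw [Finset.HasAntidiagonal.mem_antidiagonal] at hx
        rcases Nat.eq_zero_or_pos x.1 with h0 | h0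
        · rw [h0, hP, zero_mul, zero_mul]
        · rw [ih x.2 (by omega)]
      exact mul_left_cancel₀ (Nat.cast_ne_zero.2 hk.ne') e

theorem hasLogDeriv_one : HasLogDeriv (0 : PowerSeries A) 1 := by
  simp [HasLogDeriv]

theorem hasLogDeriv_mk {p h : ℕ → A} (h0 : h 0 = 1)
    (hn : ∀ k : ℕ, (k : A) * h k = ∑ x ∈ Finset.HasAntidiagonal.antidiagonal k, p x.1 * h x.2) :
    HasLogDeriv (PowerSeries.mk p) (PowerSeries.mk h) := by
  refine ⟨by simp [h0], ?_⟩
  ext k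
  rw [coeff_X_mul_derivative, PowerSeries.coeff_mul]
  simpa using hn k

theorem HasLogDeriv.map {P H : PowerSeries A} (h : HasLogDeriv P H) (f : A →+* B) :
    HasLogDeriv (PowerSeries.map f P) (PowerSeries.map f H) := by
  refine ⟨by simp [← PowerSeries.coeff_zero_eq_constantCoeff_apply,
    PowerSeries.coeff_zero_eq_constantCoeff_apply H, h.1], ?_⟩
  rw [← map_mul, ← h.2]
  ext k
  rw [coeff_X_mul_derivative, PowerSeries.coeff_map, PowerSeries.coeff_map,
    coeff_X_mul_derivative, map_mul, map_natCast]

/-- `1 + a z` has logarithmic derivative `∑ - (-a) ^ j z ^ j`. -/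
theorem hasLogDeriv_linear (a : A) :
    HasLogDeriv (PowerSeries.mk fun j => if j = 0 then 0 else -(-a) ^ j)
      (1 + PowerSeries.C a * PowerSeries.X) := by
  refine ⟨by simp, ?_⟩
  ext k
  rw [coeff_X_mul_derivative, mul_add, mul_one, mul_left_comm, map_add, PowerSeries.coeff_C_mul]
  rcases k with _ | _ | k
  · simp
  · simp [PowerSeries.coeff_one, PowerSeries.coeff_succ_mul_X]
  · simp [PowerSeries.coeff_one, PowerSeries.coeff_succ_mul_X, PowerSeries.coeff_X, pow_succ]
    ring

end LogDeriv

theorem hasLogDeriv_completeH : HasLogDeriv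
    (PowerSeries.mk fun j => (j : TimeRing) * timeVar j) (PowerSeries.mk completeH) :=
  hasLogDeriv_mk completeH_zero newton_completeH

theorem hasLogDeriv_littleQ : HasLogDeriv
    (PowerSeries.mk fun j => (j : TimeRing) * oddVar j) (PowerSeries.mk littleQ) :=
  hasLogDeriv_mk littleQ_zero newton_littleQ

theorem shift_completeH_succ (k : ℕ) : shift hallParam (completeH (k + 1)) =
    Polynomial.C (completeH (k + 1)) + Polynomial.X * shift hallParam (completeH k) := by
  have h1 := (hasLogDeriv_completeH.map (shift hallParam).toRingHom).mul
    (hasLogDeriv_linear (-Polynomial.X : Polynomial TimeRing))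
  have h2 := hasLogDeriv_completeH.map (Polynomial.C : TimeRing →+* Polynomial TimeRing)
  have hP : PowerSeries.map (shift hallParam).toRingHom
        (PowerSeries.mk fun j => (j : TimeRing) * timeVar j) +
      (PowerSeries.mk fun j => if j = 0 then 0 else -(- -Polynomial.X) ^ j) =
      PowerSeries.map Polynomial.C (PowerSeries.mk fun j => (j : TimeRing) * timeVar j) := by
    ext1 j
    simp only [map_add, PowerSeries.coeff_map, PowerSeries.coeff_mk]
    rcases Nat.eq_zero_or_pos j with rfl | hj
    · simp
    · lift j to ℕ+ using hj
      have : ((j : ℕ) : Polynomial TimeRing) * Polynomial.C (C (hallParam j)) = 1 := by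
        rw [← map_natCast Polynomial.C, ← map_natCast C, ← map_mul, ← map_mul, hallParam,
          mul_one_div_cancel (by simp), map_one, map_one]
      simp [shift_X, mul_add, ← mul_assoc, this]
  rw [hP] at h1
  have := congrArg (PowerSeries.coeff (k + 1)) (h1.unique h2)
  rw [mul_add, mul_one, mul_left_comm, map_add, PowerSeries.coeff_C_mul,
    PowerSeries.coeff_succ_mul_X] at this
  simp only [PowerSeries.coeff_map, PowerSeries.coeff_mk] at this
  simp only [AlgHom.toRingHom_eq_coe, RingHom.coe_coe] at this
  linear_combination this

theorem shift_littleQ_succ (k : ℕ) : shift qShift (littleQ (k + 1)) =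
    Polynomial.C (littleQ (k + 1)) + Polynomial.X * Polynomial.C (littleQ k) +
      Polynomial.X * shift qShift (littleQ k) := by
  have h1 := (hasLogDeriv_littleQ.map (shift qShift).toRingHom).mul
    (hasLogDeriv_linear (-Polynomial.X : Polynomial TimeRing))
  have h2 := (hasLogDeriv_littleQ.map (Polynomial.C : TimeRing →+* Polynomial TimeRing)).mul
    (hasLogDeriv_linear (Polynomial.X : Polynomial TimeRing))
  have hP : PowerSeries.map (shift qShift).toRingHom
        (PowerSeries.mk fun j => (j : TimeRing) * oddVar j) +
      (PowerSeries.mk fun j => if j = 0 then 0 else -(- -Polynomial.X) ^ j) =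
      PowerSeries.map Polynomial.C (PowerSeries.mk fun j => (j : TimeRing) * oddVar j) +
      (PowerSeries.mk fun j => if j = 0 then 0 else -(-Polynomial.X) ^ j) := by
    ext1 j
    simp only [map_add, PowerSeries.coeff_map, PowerSeries.coeff_mk]
    rcases Nat.eq_zero_or_pos j with rfl | hj
    · simp
    · lift j to ℕ+ using hj
      by_cases he : Even (j : ℕ)
      · have hX : (-Polynomial.X : Polynomial TimeRing) ^ (j : ℕ) = Polynomial.X ^ (j : ℕ) :=
          Even.neg_pow (α := Polynomial TimeRing) he Polynomial.X
        simp [oddVar, he, hX]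
      · have : ((j : ℕ) : Polynomial TimeRing) * Polynomial.C (C (qShift j)) = 2 := by
          rw [← map_natCast Polynomial.C, ← map_natCast C, ← map_mul, ← map_mul, qShift, qParam,
            if_neg he, one_mul, mul_div_cancel₀ _ (by simp), map_ofNat, map_ofNat]
        have hX : (-Polynomial.X : Polynomial TimeRing) ^ (j : ℕ) = -Polynomial.X ^ (j : ℕ) :=
          Odd.neg_pow (α := Polynomial TimeRing) (Nat.not_even_iff_odd.1 he) Polynomial.X
        simp [shift_X, mul_add, ← mul_assoc, this, oddVar, he, hX]
        ring
  rw [hP] at h1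
  have := congrArg (PowerSeries.coeff (k + 1)) (h1.unique h2)
  rw [mul_add, mul_one, mul_left_comm, map_add, PowerSeries.coeff_C_mul,
    PowerSeries.coeff_succ_mul_X, mul_add, mul_one, mul_left_comm, map_add,
    PowerSeries.coeff_C_mul, PowerSeries.coeff_succ_mul_X] at this
  simp only [PowerSeries.coeff_map, PowerSeries.coeff_mk] at this
  simp only [AlgHom.toRingHom_eq_coe, RingHom.coe_coe] at this
  linear_combination this

theorem sum_neg_one_pow_littleQ {n : ℕ} (hn : n ≠ 0) :
    ∑ x ∈ Finset.HasAntidiagonal.antidiagonal n, (-1) ^ x.1 * (littleQ x.1 * littleQ x.2) = 0 := by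
  have h : HasLogDeriv (PowerSeries.mk fun j => -((j : TimeRing) * oddVar j))
      (PowerSeries.mk fun k => (-1) ^ k * littleQ k) := by
    refine hasLogDeriv_mk (by simp [littleQ_zero]) fun k => ?_
    rw [mul_left_comm, newton_littleQ, Finset.mul_sum]
    refine Finset.sum_congr rfl fun x hx => ?_
    rw [← Finset.HasAntidiagonal.mem_antidiagonal.1 hx, pow_add, oddVar]
    split_ifs with h
    · simp
    · rw [(Nat.not_even_iff_odd.1 h).neg_one_pow]
      ring
  have h1 := h.mul hasLogDeriv_littleQ
  have h0 : (PowerSeries.mk fun j => -((j : TimeRing) * oddVar j)) +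
      (PowerSeries.mk fun j => (j : TimeRing) * oddVar j) = 0 := by
    ext1 j; simp
  rw [h0] at h1
  have := congrArg (PowerSeries.coeff n) (h1.unique hasLogDeriv_one)
  rw [PowerSeries.coeff_mul, PowerSeries.coeff_one, if_neg hn] at this
  rw [← this]
  exact Finset.sum_congr rfl fun x _ => by simp [mul_assoc]

/-! ### Orthogonality from first row expansions -/

/-- A family of functions indexed by lists is orthogonal if removing the first entry is given by
multiplication with `h_a` up to higher terms, and adjointly by the operators `d_a`. -/
theorem form_eq_ite {c : ℕ+ → ℂ} {h : ℕ → TimeRing} {d : ℕ → TimeRing → TimeRing} {κ : ℂ}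
    {P : List ℕ → Prop} {S : List ℕ → TimeRing}
    (hP : ∀ a l, P (a :: l) → P l) (hpos : ∀ a l, P (a :: l) → a ≠ 0) (hS : S [] = 1)
    (hrow : ∀ a l, P (a :: l) →
      S (a :: l) - h a * S l ∈ Submodule.span ℂ {f | ∃ m r, a < m ∧ f = h m * r})
    (hlt : ∀ b l m, P (b :: l) → b < m → d m (S (b :: l)) = 0)
    (heq : ∀ b l, P (b :: l) → d b (S (b :: l)) = κ • S l)
    (hadj : ∀ m f g, form c (h m * f) g = form c f (d m g))
    (hone : ∀ m, m ≠ 0 → d m 1 = 0) (l : List ℕ) :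
    ∀ l', P l → P l' → form c (S l) (S l') = if l = l' then κ ^ l.length else 0 := by
  have key : ∀ a l g, P (a :: l) → (∀ m, a < m → d m g = 0) →
      form c (S (a :: l)) g = form c (S l) (d a g) := by
    intro a l g hal hg
    have hker : Submodule.span ℂ {f | ∃ m r, a < m ∧ f = h m * r} ≤
        LinearMap.ker ((form c).flip g) := by
      rw [Submodule.span_le]
      rintro f ⟨m, r, hm, rfl⟩
      simp [hadj, hg m hm]
    have := hker (hrow a l hal)
    rwa [LinearMap.mem_ker, LinearMap.flip_apply, map_sub, LinearMap.sub_apply, sub_eq_zero,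
      hadj] at this
  induction l with
  | nil =>
    rintro (_ | ⟨b, l'⟩) - hb
    · simp [hS, form_one_left]
    · have hb0 := hpos b l' hb
      rw [if_neg (by simp), form_symm, hS,
        key b l' 1 hb fun m hm => hone m (by omega), hone b hb0, map_zero]
  | cons a l ih =>
    rintro (_ | ⟨b, l'⟩) ha hb
    · have ha0 := hpos a l ha
      rw [if_neg (by simp), hS, key a l 1 ha fun m hm => hone m (by omega), hone a ha0, map_zero]
    · rcases lt_trichotomy a b with hab | rfl | hab
      · rw [if_neg (by simp [hab.ne]), form_symm,
          key b l' _ hb fun m hm => hlt a l m ha (hab.trans hm), hlt a l b ha hab, map_zero]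
      · rw [key a l _ ha fun m hm => hlt a l' m hb hm, heq a l' hb, map_smul,
          ih l' (hP a l ha) (hP a l' hb)]
        simp only [List.cons.injEq, true_and, List.length_cons, smul_eq_mul, mul_ite, mul_zero,
          pow_succ']
      · rw [if_neg (by simp [hab.ne']), key a l _ ha fun m hm => hlt b l' m hb (hab.trans hm),
          hlt b l' a hb hab, map_zero]

/-! ### Orthonormality of Schur functions -/

theorem completeHInt_natCast (k : ℕ) : completeHInt (k : ℤ) = completeH k := by
  simp [completeHInt]

theorem completeHInt_of_neg {k : ℤ} (hk : k < 0) : completeHInt k = 0 := by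
  simp [completeHInt, hk]

theorem shift_completeHInt (k : ℤ) : shift hallParam (completeHInt k) =
    Polynomial.C (completeHInt k) + Polynomial.X * shift hallParam (completeHInt (k - 1)) := by
  rcases lt_or_ge k 0 with hk | hk
  · rw [completeHInt_of_neg hk, completeHInt_of_neg (by omega)]
    simp
  · lift k to ℕ using hk
    rcases k with _ | k
    · rw [completeHInt_natCast, completeH_zero, completeHInt_of_neg (by simp)]
      simp
    · have : ((k + 1 : ℕ) : ℤ) - 1 = (k : ℕ) := by push_cast; ring
      rw [this, completeHInt_natCast, completeHInt_natCast, shift_completeH_succ]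

theorem coeff_shift_completeHInt (m : ℕ) (k : ℤ) :
    (shift hallParam (completeHInt k)).coeff m = completeHInt (k - m) := by
  induction m generalizing k with
  | zero =>
    rw [shift_completeHInt]
    simp
  | succ m ih =>
    rw [shift_completeHInt, Polynomial.coeff_add, Polynomial.coeff_X_mul, ih,
      Polynomial.coeff_C_succ, zero_add]
    congr 1
    push_cast; ring

/-- The Jacobi–Trudi matrix of a sequence. -/
def jacobiTrudiMatrix {k : ℕ} (f : Fin k → ℕ) : Matrix (Fin k) (Fin k) TimeRing :=
  Matrix.of fun i j => completeHInt ((f i : ℤ) - (i : ℤ) + (j : ℤ))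

theorem jacobiTrudiMatrix_submatrix_succ {k : ℕ} (f : Fin (k + 1) → ℕ) :
    (jacobiTrudiMatrix f).submatrix Fin.succ Fin.succ = jacobiTrudiMatrix fun i => f i.succ := by
  ext1 i j
  simp only [jacobiTrudiMatrix, Matrix.submatrix_apply, Matrix.of_apply, Fin.val_succ]
  congr 1
  push_cast; ring

/-- The Jacobi–Trudi determinant of a list. -/
def jacobiTrudi (l : List ℕ) : TimeRing := (jacobiTrudiMatrix l.get).det

theorem card_sortedParts (s : Multiset ℕ) : (sortedParts s).length = s.card :=
  Multiset.length_sort _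

theorem schurS_eq (s : Multiset ℕ) : schurS s = jacobiTrudi (sortedParts s) := by
  rw [schurS, jacobiTrudi, ← Matrix.det_reindex_self (finCongr (card_sortedParts s).symm)]
  congr 1
  ext1 i j
  simp [part, jacobiTrudiMatrix]

theorem det_jacobiTrudiMatrix_sub_mem {k : ℕ} (f : Fin (k + 1) → ℕ) :
    (jacobiTrudiMatrix f).det - completeH (f 0) * (jacobiTrudiMatrix fun i => f i.succ).det ∈
      Submodule.span ℂ {g | ∃ m r, f 0 < m ∧ g = completeH m * r} := by
  have hrow (j : Fin (k + 1)) : jacobiTrudiMatrix f 0 j = completeH (f 0 + j) := by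
    rw [← completeHInt_natCast]
    simp [jacobiTrudiMatrix]
  rw [Matrix.det_succ_row_zero, Fin.sum_univ_succ, Fin.succAbove_zero,
    jacobiTrudiMatrix_submatrix_succ]
  simp only [hrow, Fin.val_zero, pow_zero, one_mul, add_zero, add_sub_cancel_left]
  exact Submodule.sum_mem _ fun j _ => Submodule.subset_span
    ⟨f 0 + j.succ, (-1) ^ (j.succ : ℕ) * ((jacobiTrudiMatrix f).submatrix Fin.succ
      j.succ.succAbove).det, by simp, by ring⟩

theorem shift_det_jacobiTrudiMatrix {k : ℕ} (f : Fin (k + 1) → ℕ) :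
    shift hallParam (jacobiTrudiMatrix f).det =
    ∑ i : Fin (k + 1), Polynomial.C ((-1) ^ (i : ℕ)) *
      shift hallParam (completeHInt ((f i : ℤ) - (i : ℤ))) *
      Polynomial.C ((jacobiTrudiMatrix f).submatrix i.succAbove Fin.succ).det := by
  rw [AlgHom.map_det, Matrix.det_eq_of_forall_col_eq_smul_add_pred
    (B := Matrix.of fun i j => Fin.cases
      (shift hallParam (completeHInt ((f i : ℤ) - (i : ℤ))))
      (fun j => Polynomial.C (jacobiTrudiMatrix f i j.succ)) j)
    (fun _ => Polynomial.X), Matrix.det_succ_column_zero]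
  · refine Finset.sum_congr rfl fun i _ => ?_
    rw [RingHom.map_det, map_pow, map_neg, map_one]
    rfl
  · intro i
    simp [jacobiTrudiMatrix]
  · intro i j
    simp only [AlgHom.mapMatrix_apply, Matrix.map_apply, Matrix.of_apply, Fin.cases_succ,
      jacobiTrudiMatrix]
    rw [shift_completeHInt]
    congr 4
    simp only [Fin.val_succ, Fin.val_castSucc]
    push_cast; ring

theorem skew_det_jacobiTrudiMatrix {k : ℕ} (f : Fin (k + 1) → ℕ) (hf : ∀ i, f i ≤ f 0) (m : ℕ)
    (hm : f 0 ≤ m) : skew hallParam m (jacobiTrudiMatrix f).det =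
      if m = f 0 then (jacobiTrudiMatrix fun i => f i.succ).det else 0 := by
  simp only [skew_apply, shift_det_jacobiTrudiMatrix, Polynomial.finsetSum_coeff,
    Polynomial.coeff_mul_C, Polynomial.coeff_C_mul, coeff_shift_completeHInt]
  rw [Fin.sum_univ_succ, Finset.sum_eq_zero, add_zero]
  · rw [Fin.succAbove_zero, jacobiTrudiMatrix_submatrix_succ]
    simp only [Fin.val_zero, pow_zero, one_mul, Nat.cast_zero, sub_zero]
    split_ifs with h
    · rw [h, sub_self, ← Nat.cast_zero, completeHInt_natCast, completeH_zero, one_mul]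
    · rw [completeHInt_of_neg (by omega), zero_mul]
  · intro i _
    have := hf i.succ
    rw [completeHInt_of_neg (by rw [Fin.val_succ]; omega), mul_zero, zero_mul]

theorem jacobiTrudi_cons_sub_mem (a : ℕ) (l : List ℕ) :
    jacobiTrudi (a :: l) - completeH a * jacobiTrudi l ∈
      Submodule.span ℂ {f | ∃ m r, a < m ∧ f = completeH m * r} :=
  det_jacobiTrudiMatrix_sub_mem (k := l.length) (a :: l).get

theorem skew_jacobiTrudi_cons (b : ℕ) (l : List ℕ) (m : ℕ) (hl : (b :: l).Pairwise (· ≥ ·))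
    (hm : b ≤ m) : skew hallParam m (jacobiTrudi (b :: l)) =
      if m = b then jacobiTrudi l else 0 := by
  refine skew_det_jacobiTrudiMatrix (k := l.length) (b :: l).get (fun i => ?_) m hm
  refine Fin.cases le_rfl (fun i => ?_) i
  exact List.rel_of_pairwise_cons hl (List.get_mem l i)

theorem form_jacobiTrudi (l l' : List ℕ) (hl : l.Pairwise (· ≥ ·) ∧ ∀ i ∈ l, 0 < i)
    (hl' : l'.Pairwise (· ≥ ·) ∧ ∀ i ∈ l', 0 < i) :
    form hallParam (jacobiTrudi l) (jacobiTrudi l') = if l = l' then 1 else 0 := by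
  have := form_eq_ite (c := hallParam) (h := completeH) (d := fun m => skew hallParam m) (κ := 1)
    (P := fun l => l.Pairwise (· ≥ ·) ∧ ∀ i ∈ l, 0 < i) (S := jacobiTrudi)
    (fun a l h => ⟨h.1.of_cons, fun i hi => h.2 i (List.mem_cons_of_mem _ hi)⟩)
    (fun a l h => (h.2 a List.mem_cons_self).ne') Matrix.det_fin_zero
    (fun a l _ => jacobiTrudi_cons_sub_mem a l)
    (fun b l m h hm => by rw [skew_jacobiTrudi_cons b l m h.1 hm.le, if_neg hm.ne'])
    (fun b l h => by rw [skew_jacobiTrudi_cons b l b h.1 le_rfl, if_pos rfl, one_smul])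
    form_completeH_mul (fun m hm => by rw [skew_one, if_neg hm]) l l' hl hl'
  simpa using this

theorem sortedParts_pairwise (s : Multiset ℕ) : (sortedParts s).Pairwise (· ≥ ·) :=
  Multiset.pairwise_sort _ _

theorem coe_sortedParts (s : Multiset ℕ) : (sortedParts s : Multiset ℕ) = s :=
  Multiset.sort_eq _ _

theorem mem_sortedParts {s : Multiset ℕ} {i : ℕ} : i ∈ sortedParts s ↔ i ∈ s :=
  Multiset.mem_sort _

theorem form_schurS {s s' : Multiset ℕ} (hs : ∀ i ∈ s, 0 < i) (hs' : ∀ i ∈ s', 0 < i) :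
    form hallParam (schurS s) (schurS s') = if s = s' then 1 else 0 := by
  rw [schurS_eq, schurS_eq, form_jacobiTrudi _ _
    ⟨sortedParts_pairwise s, fun i hi => hs i (mem_sortedParts.1 hi)⟩
    ⟨sortedParts_pairwise s', fun i hi => hs' i (mem_sortedParts.1 hi)⟩]
  have : sortedParts s = sortedParts s' ↔ s = s' :=
    ⟨fun h => by rw [← coe_sortedParts s, h, coe_sortedParts], fun h => by rw [h]⟩
  simp only [this]

/-! ### Skewing operators commute -/

theorem skew_comm (c : ℕ+ → ℂ) (m n : ℕ) (v : TimeRing) :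
    skew c m (skew c n v) = skew c n (skew c m v) := by
  induction v using MvPolynomial.induction_on generalizing m n with
  | C a =>
    rw [skew_C, skew_C]
    split_ifs <;> simp_all [skew_C]
  | add p q hp hq => simp only [map_add, hp, hq]
  | mul_X p j hp =>
    rw [mul_comm, skew_X_mul, skew_X_mul, map_add, map_add, skew_X_mul, skew_X_mul, hp m n]
    have (k l : ℕ) : skew c k (if (j : ℕ) ≤ l then C (c j) * skew c (l - j) p else 0) =
        if (j : ℕ) ≤ l then C (c j) * skew c k (skew c (l - j) p) else 0 := by
      split_ifs
      · rw [← smul_eq_C_mul, map_smul, smul_eq_C_mul]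
      · simp
    rw [this, this, hp m (n - j), hp (m - j) n]
    ring

theorem skew_zero (c : ℕ+ → ℂ) (v : TimeRing) : skew c 0 v = v := by
  induction v using MvPolynomial.induction_on with
  | C a => simp [skew_C]
  | add p q hp hq => simp only [map_add, hp, hq]
  | mul_X p j hp => simp [mul_comm p, skew_X_mul, hp]

theorem skew_eq_zero (c : ℕ+ → ℂ) (v : TimeRing) :
    ∃ N, ∀ i, N ≤ i → skew c i v = 0 :=
  ⟨(shift c v).natDegree + 1, fun _ hi => Polynomial.coeff_eq_zero_of_natDegree_lt hi⟩

/-! ### The vertex operators of the `Q`-functions -/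

/-- `q_k` for an integer `k`, zero for negative `k`. -/
def littleQInt (k : ℤ) : TimeRing := if 0 ≤ k then littleQ k.toNat else 0

theorem littleQInt_natCast (k : ℕ) : littleQInt (k : ℤ) = littleQ k := by
  simp [littleQInt]

theorem littleQInt_of_neg {k : ℤ} (hk : k < 0) : littleQInt k = 0 := by
  simp [littleQInt, hk]

theorem shift_littleQInt (k : ℤ) : shift qShift (littleQInt k) =
    Polynomial.C (littleQInt k) + Polynomial.X * Polynomial.C (littleQInt (k - 1)) +
      Polynomial.X * shift qShift (littleQInt (k - 1)) := by
  rcases lt_or_ge k 0 with hk | hk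
  · rw [littleQInt_of_neg hk, littleQInt_of_neg (by omega)]
    simp
  · lift k to ℕ using hk
    rcases k with _ | k
    · rw [littleQInt_natCast, littleQ_zero, littleQInt_of_neg (by simp)]
      simp
    · have : ((k + 1 : ℕ) : ℤ) - 1 = (k : ℕ) := by push_cast; ring
      rw [this, littleQInt_natCast, littleQInt_natCast, shift_littleQ_succ]

theorem skew_succ_littleQInt_mul (m : ℕ) (k : ℤ) (v : TimeRing) :
    skew qShift (m + 1) (littleQInt k * v) = skew qShift m (littleQInt (k - 1) * v) +
      littleQInt k * skew qShift (m + 1) v + littleQInt (k - 1) * skew qShift m v := by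
  simp only [skew_apply, map_mul]
  rw [shift_littleQInt k, add_mul, add_mul, Polynomial.coeff_add, Polynomial.coeff_add,
    Polynomial.coeff_C_mul, mul_assoc, Polynomial.coeff_X_mul, Polynomial.coeff_C_mul, mul_assoc,
    Polynomial.coeff_X_mul]
  ring

/-- The vertex operator `∑_i (-1)^i q_{a+i} q_i^⊥`. -/
def vertex (a : ℤ) : TimeRing →ₗ[ℂ] TimeRing :=
  Polynomial.lsum (fun i => (-1 : ℂ) ^ i • LinearMap.mulLeft ℂ (littleQInt (a + i))) ∘ₗ
    (shift qShift).toLinearMap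

theorem vertex_eq_sum (a : ℤ) {v : TimeRing} {N : ℕ} (hN : ∀ i, N ≤ i → skew qShift i v = 0) :
    vertex a v = ∑ i ∈ Finset.range N, (-1) ^ i * (littleQInt (a + i) * skew qShift i v) := by
  have hs : (shift qShift v).support ⊆ Finset.range N := fun i hi => by
    rw [Finset.mem_range]
    by_contra h
    exact Polynomial.mem_support_iff.1 hi (hN i (not_lt.1 h))
  rw [vertex, LinearMap.comp_apply, AlgHom.toLinearMap_apply, Polynomial.lsum_apply,
    Polynomial.sum_eq_of_subset _ (fun i => map_zero _) hs]
  refine Finset.sum_congr rfl fun i _ => ?_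
  rw [LinearMap.smul_apply, LinearMap.mulLeft_apply, smul_eq_C_mul, map_pow, map_neg, map_one,
    skew_apply]

theorem vertex_littleQInt_mul (a k : ℤ) (v : TimeRing) :
    vertex a (littleQInt k * v) = -vertex (a + 1) (littleQInt (k - 1) * v) +
      littleQInt k * vertex a v - littleQInt (k - 1) * vertex (a + 1) v := by
  obtain ⟨N₁, h₁⟩ := skew_eq_zero qShift v
  obtain ⟨N₂, h₂⟩ := skew_eq_zero qShift (littleQInt k * v)
  obtain ⟨N₃, h₃⟩ := skew_eq_zero qShift (littleQInt (k - 1) * v)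
  set N := max N₁ (max N₂ N₃) with hN
  rw [vertex_eq_sum (N := N + 1) a fun i hi => h₂ i (by omega),
    vertex_eq_sum (N := N) (a + 1) fun i hi => h₃ i (by omega),
    vertex_eq_sum (N := N + 1) a fun i hi => h₁ i (by omega),
    vertex_eq_sum (N := N) (a + 1) fun i hi => h₁ i (by omega),
    Finset.sum_range_succ', Finset.sum_range_succ']
  simp only [skew_succ_littleQInt_mul, skew_zero, mul_add, Finset.mul_sum, ← Finset.sum_neg_distrib]
  rw [← add_assoc, add_sub_right_comm]
  congr 1
  · rw [← Finset.sum_add_distrib, ← Finset.sum_sub_distrib]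
    refine Finset.sum_congr rfl fun i _ => ?_
    have : a + 1 + (i : ℤ) = a + ((i + 1 : ℕ) : ℤ) := by push_cast; ring
    rw [this, pow_succ]
    ring
  · ring

theorem skew_succ_vertex (m : ℕ) (a : ℤ) (v : TimeRing) :
    skew qShift (m + 1) (vertex a v) = skew qShift m (vertex (a - 1) v) +
      vertex a (skew qShift (m + 1) v) + vertex (a - 1) (skew qShift m v) := by
  obtain ⟨N, hN⟩ := skew_eq_zero qShift v
  have hN' : ∀ k i, N ≤ i → skew qShift i (skew qShift k v) = 0 := fun k i hi => by
    rw [skew_comm, hN i hi, map_zero]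
  rw [vertex_eq_sum a hN, vertex_eq_sum (a - 1) hN, vertex_eq_sum a (hN' _),
    vertex_eq_sum (a - 1) (hN' _), map_sum, map_sum, ← Finset.sum_add_distrib,
    ← Finset.sum_add_distrib]
  refine Finset.sum_congr rfl fun i _ => ?_
  have hs (n : ℕ) (f : TimeRing) : skew qShift n ((-1) ^ i * f) = (-1) ^ i * skew qShift n f := by
    rcases neg_one_pow_eq_or TimeRing i with h | h <;> simp [h]
  rw [hs, hs, skew_succ_littleQInt_mul, skew_comm _ i, skew_comm _ i,
    show a + (i : ℤ) - 1 = a - 1 + i by ring]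
  ring

/-- The normally ordered product of two vertex operators. -/
def vertexPair (N : ℕ) (a b : ℤ) (v : TimeRing) : TimeRing :=
  ∑ i ∈ Finset.range N, ∑ j ∈ Finset.range N, (-1) ^ (i + j) *
    (littleQInt (b + i) * littleQInt (a + j) * skew qShift j (skew qShift i v))

theorem vertexPair_comm (N : ℕ) (a b : ℤ) (v : TimeRing) :
    vertexPair N a b v = vertexPair N b a v := by
  rw [vertexPair, Finset.sum_comm, vertexPair]
  refine Finset.sum_congr rfl fun i _ => Finset.sum_congr rfl fun j _ => ?_
  rw [skew_comm, add_comm, mul_comm (littleQInt _)]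

theorem vertex_vertex_add {N : ℕ} {v : TimeRing} (hN : ∀ i, N ≤ i → skew qShift i v = 0)
    (a b : ℤ) : vertex a (vertex b v) + vertex (a + 1) (vertex (b - 1) v) =
      vertexPair N a b v - vertexPair N (a + 1) (b - 1) v := by
  have hN' : ∀ k i, N ≤ i → skew qShift i (skew qShift k v) = 0 := fun k i hi => by
    rw [skew_comm, hN i hi, map_zero]
  rw [vertex_eq_sum b hN, vertex_eq_sum (b - 1) hN, map_sum, map_sum, vertexPair, vertexPair,
    ← Finset.sum_add_distrib, ← Finset.sum_sub_distrib]
  refine Finset.sum_congr rfl fun i _ => ?_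
  have hs (n : ℤ) (f : TimeRing) : vertex n ((-1) ^ i * f) = (-1) ^ i * vertex n f := by
    rcases neg_one_pow_eq_or TimeRing i with h | h <;> simp [h]
  rw [hs, hs, vertex_littleQInt_mul, show b + (i : ℤ) - 1 = b - 1 + i by ring,
    vertex_eq_sum a (hN' _), vertex_eq_sum (a + 1) (hN' _)]
  simp only [pow_add, mul_assoc, ← Finset.mul_sum, mul_left_comm _ (littleQInt (b + i)),
    mul_left_comm _ (littleQInt (b - 1 + i))]
  ring

theorem sum_neg_one_pow_littleQInt {A B K : ℕ} (h : A + B ≠ 0) (hB : B ≤ K) (hA : A < K) :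
    ∑ t ∈ Finset.range (K + K), (-1) ^ t *
      (littleQInt ((A : ℤ) + K - t) * littleQInt ((B : ℤ) - K + t)) = 0 := by
  have hK : K + K = (K - B) + ((A + B + 1) + (K - A - 1)) := by omega
  rw [hK, Finset.sum_range_add, Finset.sum_range_add, Finset.sum_eq_zero, zero_add,
    Finset.sum_eq_zero (s := Finset.range (K - A - 1)), add_zero]
  · have := sum_neg_one_pow_littleQ h
    rw [Finset.Nat.sum_antidiagonal_eq_sum_range_succ_mk] at this
    rw [← mul_zero ((-1) ^ (K - B)), ← this, Finset.mul_sum]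
    refine Finset.sum_congr rfl fun u hu => ?_
    have hu' := Finset.mem_range.1 hu
    rw [← littleQInt_natCast u, ← littleQInt_natCast (A + B - u), pow_add, mul_assoc,
      mul_comm (littleQInt (u : ℤ))]
    congr 4 <;> [skip; omega]
    omega
  · intro t _
    rw [littleQInt_of_neg (by omega), zero_mul, mul_zero]
  · intro t ht
    have ht' := Finset.mem_range.1 ht
    rw [littleQInt_of_neg (k := (B : ℤ) - K + t) (by omega), mul_zero, mul_zero]

/-- The square of a vertex operator of positive degree vanishes. -/
theorem vertex_vertex_self {b : ℕ} (hb : b ≠ 0) (v : TimeRing) :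
    vertex b (vertex b v) = 0 := by
  obtain ⟨N, hN⟩ := skew_eq_zero qShift v
  set K := b + N with hK
  have htel : ∀ n : ℕ, vertex b (vertex b v) =
      ∑ k ∈ Finset.range n, (-1) ^ k * (vertexPair N (b + k) (b - k) v -
        vertexPair N (b + (k + 1 : ℕ)) (b - (k + 1 : ℕ)) v) +
      (-1) ^ n * vertex (b + n) (vertex (b - n) v) := by
    intro n
    induction n with
    | zero => simp
    | succ n ih =>
      have := vertex_vertex_add hN (b + n) (b - n)
      rw [show (b : ℤ) + n + 1 = b + (n + 1 : ℕ) by push_cast; ring,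
        show (b : ℤ) - n - 1 = b - (n + 1 : ℕ) by push_cast; ring] at this
      rw [ih, Finset.sum_range_succ, ← this, pow_succ]
      ring
  have hlast : vertex (b - K : ℤ) v = 0 := by
    rw [vertex_eq_sum _ hN]
    refine Finset.sum_eq_zero fun i hi => ?_
    have := Finset.mem_range.1 hi
    rw [littleQInt_of_neg (by omega), zero_mul, mul_zero]
  have hsum : ∑ t ∈ Finset.range (K + K), (-1) ^ t *
      vertexPair N ((b : ℤ) - K + t) ((b : ℤ) + K - t) v = 0 := by
    simp only [vertexPair, Finset.mul_sum]
    rw [Finset.sum_comm]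
    refine Finset.sum_eq_zero fun i hi => ?_
    rw [Finset.sum_comm]
    refine Finset.sum_eq_zero fun j hj => ?_
    have hi' := Finset.mem_range.1 hi
    have hj' := Finset.mem_range.1 hj
    have := sum_neg_one_pow_littleQInt (A := b + i) (B := b + j) (K := K) (by omega) (by omega)
      (by omega)
    have h2 := congrArg (fun x => (-1) ^ (i + j) * x * skew qShift j (skew qShift i v)) this
    simp only [mul_zero, zero_mul, Finset.mul_sum, Finset.sum_mul] at h2
    rw [← h2]
    refine Finset.sum_congr rfl fun t _ => ?_
    rw [show (b : ℤ) + K - t + i = (b + i : ℕ) + K - t by push_cast; ring,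
      show (b : ℤ) - K + t + j = (b + j : ℕ) - K + t by push_cast; ring]
    ring
  rw [htel K, hlast, map_zero, mul_zero, add_zero]
  clear_value K
  rw [Finset.sum_range_add, ← Finset.sum_range_reflect] at hsum
  have hpow : ((-1) ^ K * (-1) ^ K : TimeRing) = 1 := by
    rw [← mul_pow]; simp
  rw [← mul_zero ((-1) ^ K), ← hsum, mul_add, add_comm, Finset.mul_sum, Finset.mul_sum,
    ← Finset.sum_add_distrib]
  refine Finset.sum_congr rfl fun k hk => ?_
  have hk' := Finset.mem_range.1 hk
  have h1 : (b : ℤ) - K + (K + k : ℕ) = b + k := by push_cast; ring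
  have h2 : (b : ℤ) + K - (K + k : ℕ) = b - k := by push_cast; ring
  have h3 : (b : ℤ) - K + (K - 1 - k : ℕ) = b - (k + 1 : ℕ) := by omega
  have h4 : (b : ℤ) + K - (K - 1 - k : ℕ) = b + (k + 1 : ℕ) := by omega
  have h5 : ((-1) ^ K * (-1) ^ (K - 1 - k) : TimeRing) = -(-1) ^ k := by
    rw [← pow_add, show K + (K - 1 - k) = 2 * (K - 1 - k) + (k + 1) by omega, pow_add, pow_mul,
      neg_one_sq, one_pow, pow_succ]
    ring
  rw [vertexPair_comm N (b + (k + 1 : ℕ)), h1, h2, h3, h4, pow_add, ← mul_assoc, ← mul_assoc,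
    ← mul_assoc, hpow, h5]
  ring

/-! ### Orthogonality of iterated vertex operators -/

/-- The vertex operators of the entries of a list applied to `1`. -/
def vertexQ : List ℕ → TimeRing
  | [] => 1
  | a :: l => vertex a (vertexQ l)

theorem skew_vertex_of_lt {b : ℕ} {v : TimeRing} (hv : ∀ m, b < m → skew qShift m v = 0)
    (hb : ∀ m, b ≤ m → skew qShift m (vertex b v) + vertex b (skew qShift m v) =
      if m = b then (2 : ℂ) • v else 0) {a m : ℕ} (ha : b < a) (hm : a ≤ m) :
    skew qShift m (vertex a v) = if m = a then (2 : ℂ) • v else 0 := by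
  obtain ⟨k, rfl⟩ := Nat.exists_eq_add_of_lt ha
  clear ha
  induction k generalizing m with
  | zero =>
    obtain ⟨m, rfl⟩ := Nat.exists_eq_add_of_le' (show 1 ≤ m by omega)
    have := hb m (by omega)
    rw [skew_succ_vertex, hv (m + 1) (by omega), map_zero, add_zero,
      show ((b + 0 + 1 : ℕ) : ℤ) - 1 = b by push_cast; ring, this]
    simp
  | succ k ih =>
    obtain ⟨m, rfl⟩ := Nat.exists_eq_add_of_le' (show 1 ≤ m by omega)
    rw [skew_succ_vertex, hv (m + 1) (by omega), hv m (by omega), map_zero, map_zero, add_zero,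
      add_zero, show ((b + (k + 1) + 1 : ℕ) : ℤ) - 1 = (b + k + 1 : ℕ) by push_cast; ring,
      ih (by omega)]
    simp only [← add_assoc, Nat.add_right_cancel_iff]

theorem vertex_zero_one : vertex 0 1 = 1 := by
  rw [vertex_eq_sum (N := 1) 0 fun i hi => by rw [skew_one, if_neg (by omega)]]
  have : littleQInt 0 = 1 := (littleQInt_natCast 0).trans littleQ_zero
  simp [skew_one, this]

theorem skew_vertexQ_cons {a : ℕ} {l : List ℕ} (hl : (a :: l).Pairwise (· > ·))
    (hpos : ∀ i ∈ a :: l, 0 < i) {m : ℕ} (hm : a ≤ m) :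
    skew qShift m (vertexQ (a :: l)) = if m = a then (2 : ℂ) • vertexQ l else 0 := by
  induction l generalizing a m with
  | nil =>
    refine skew_vertex_of_lt (b := 0) (fun m hm => ?_) (fun m _ => ?_) (hpos a (by simp)) hm
    · rw [vertexQ, skew_one, if_neg hm.ne']
    · rw [vertexQ, Nat.cast_zero, vertex_zero_one, skew_one]
      split_ifs
      · rw [vertex_zero_one, two_smul]
      · simp
  | cons b l ih =>
    have hl' := hl.of_cons
    have hpos' : ∀ i ∈ b :: l, 0 < i := fun i hi => hpos i (List.mem_cons_of_mem _ hi)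
    have hab : b < a := List.rel_of_pairwise_cons hl (by simp)
    refine skew_vertex_of_lt (fun m hm => ?_) (fun m hm => ?_) hab hm
    · rw [ih hl' hpos' hm.le, if_neg hm.ne']
    · rw [ih hl' hpos' hm, vertexQ, vertex_vertex_self (hpos' b (by simp)).ne', map_zero, zero_add]
      split_ifs
      · rw [map_smul]
      · rw [map_zero]

theorem vertexQ_cons_eq (a : ℕ) (l : List ℕ) : ∃ N, vertexQ (a :: l) =
    littleQ a * vertexQ l + ∑ i ∈ Finset.range N,
      (-1) ^ (i + 1) * (littleQ (a + (i + 1)) * skew qShift (i + 1) (vertexQ l)) := by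
  obtain ⟨N, hN⟩ := skew_eq_zero qShift (vertexQ l)
  refine ⟨N, ?_⟩
  change vertex a (vertexQ l) = _
  generalize vertexQ l = v at hN ⊢
  rw [vertex_eq_sum (N := N + 1) _ fun i hi => hN i (by omega), Finset.sum_range_succ', add_comm,
    Nat.cast_zero, add_zero, littleQInt_natCast, skew_zero, pow_zero, one_mul]
  simp only [← Nat.cast_add, littleQInt_natCast]

theorem form_vertexQ {l l' : List ℕ} (hl : l.Pairwise (· > ·) ∧ ∀ i ∈ l, 0 < i)
    (hl' : l'.Pairwise (· > ·) ∧ ∀ i ∈ l', 0 < i) :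
    form qParam (vertexQ l) (vertexQ l') = if l = l' then 2 ^ l.length else 0 := by
  refine form_eq_ite (c := qParam) (h := littleQ) (d := fun m => skew qShift m) (κ := 2)
    (P := fun l => l.Pairwise (· > ·) ∧ ∀ i ∈ l, 0 < i) (S := vertexQ)
    (fun a l h => ⟨h.1.of_cons, fun i hi => h.2 i (List.mem_cons_of_mem _ hi)⟩)
    (fun a l h => (h.2 a List.mem_cons_self).ne') rfl (fun a l _ => ?_)
    (fun b l m h hm => by rw [skew_vertexQ_cons h.1 h.2 hm.le, if_neg hm.ne'])
    (fun b l h => by rw [skew_vertexQ_cons h.1 h.2 le_rfl, if_pos rfl])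
    form_littleQ_mul (fun m hm => by rw [skew_one, if_neg hm]) l l' hl hl'
  obtain ⟨N, hN⟩ := vertexQ_cons_eq a l
  rw [hN, add_sub_cancel_left]
  exact Submodule.sum_mem _ fun i _ => Submodule.subset_span
    ⟨a + (i + 1), (-1) ^ (i + 1) * skew qShift (i + 1) (vertexQ l), by omega, by ring⟩

/-! ### The filtration of the products of the `q_k` -/

/-- The product of the `q_k` over a multiset. -/
def qProd (s : Multiset ℕ) : TimeRing := (s.map littleQ).prod

/-- The weight of a multiset, which orders the strict partitions lexicographically. -/
def qWeight (s : Multiset ℕ) : ℕ := (s.map fun a => 2 ^ a - 1).sum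

theorem qProd_add (s t : Multiset ℕ) : qProd (s + t) = qProd s * qProd t := by
  simp [qProd]

theorem qProd_cons (a : ℕ) (s : Multiset ℕ) : qProd (a ::ₘ s) = littleQ a * qProd s := by
  simp [qProd]

theorem qWeight_add (s t : Multiset ℕ) : qWeight (s + t) = qWeight s + qWeight t := by
  simp [qWeight]

theorem qWeight_cons (a : ℕ) (s : Multiset ℕ) : qWeight (a ::ₘ s) = (2 ^ a - 1) + qWeight s := by
  simp [qWeight]

/-- The span of the products of degree `n` and of weight at least `c`. -/
def qFilt (n c : ℕ) : Submodule ℂ TimeRing :=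
  Submodule.span ℂ {f | ∃ s : Multiset ℕ, s.sum = n ∧ c ≤ qWeight s ∧ f = qProd s}

theorem qProd_mem_qFilt {s : Multiset ℕ} {n c : ℕ} (hn : s.sum = n) (hc : c ≤ qWeight s) :
    qProd s ∈ qFilt n c :=
  Submodule.subset_span ⟨s, hn, hc, rfl⟩

theorem qFilt_mono {n c d : ℕ} (h : c ≤ d) : qFilt n d ≤ qFilt n c :=
  Submodule.span_mono fun _ ⟨s, hn, hc, hs⟩ => ⟨s, hn, h.trans hc, hs⟩

theorem mul_mem_qFilt {n m c d : ℕ} {f g : TimeRing} (hf : f ∈ qFilt n c) (hg : g ∈ qFilt m d) :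
    f * g ∈ qFilt (n + m) (c + d) := by
  have := Submodule.mul_mem_mul hf hg
  rw [qFilt, qFilt, Submodule.span_mul_span] at this
  refine Submodule.span_mono ?_ this
  rintro _ ⟨_, ⟨s, hs, hc, rfl⟩, _, ⟨t, ht, hd, rfl⟩, rfl⟩
  exact ⟨s + t, by rw [Multiset.sum_add, hs, ht], by rw [qWeight_add]; omega, (qProd_add s t).symm⟩

theorem littleQ_mem_qFilt (k : ℕ) : littleQ k ∈ qFilt k (2 ^ k - 1) :=
  Submodule.subset_span ⟨{k}, by simp, by simp [qWeight], by simp [qProd]⟩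

theorem neg_one_pow_mul_mem {V : Submodule ℂ TimeRing} (i : ℕ) {f : TimeRing} (hf : f ∈ V) :
    (-1) ^ i * f ∈ V := by
  rcases neg_one_pow_eq_or TimeRing i with h | h <;> simp [h, hf]

theorem skew_succ_littleQInt (m : ℕ) (k : ℤ) :
    skew qShift (m + 1) (littleQInt k) = 2 * littleQInt (k - (m + 1)) := by
  induction m generalizing k with
  | zero =>
    have := skew_succ_littleQInt_mul 0 k 1
    simp only [mul_one, skew_zero, skew_one] at this
    rw [this]
    simp
    ring
  | succ m ih =>
    have := skew_succ_littleQInt_mul (m + 1) k 1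
    simp only [mul_one, skew_one, ih] at this
    rw [this]
    simp
    congr 1
    ring

theorem skew_qProd_mem (m : ℕ) (s : Multiset ℕ) : skew qShift m (qProd s) ∈
    Submodule.span ℂ {f | ∃ t : Multiset ℕ, t.sum + m = s.sum ∧ f = qProd t} := by
  induction s using Multiset.induction_on generalizing m with
  | empty =>
    simp only [qProd, Multiset.map_zero, Multiset.prod_zero, skew_one]
    split_ifs with h
    · exact Submodule.subset_span ⟨0, by simp [h], by simp⟩
    · exact Submodule.zero_mem _
  | cons a s ih =>
    rw [qProd_cons, skew_apply, map_mul, Polynomial.coeff_mul]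
    refine Submodule.sum_mem _ fun x hx => ?_
    rw [Finset.HasAntidiagonal.mem_antidiagonal] at hx
    rw [← skew_apply, ← skew_apply]
    have hmem : ∀ j, j + x.1 = a → ∀ g, g ∈ Submodule.span ℂ
        {f | ∃ t : Multiset ℕ, t.sum + x.2 = s.sum ∧ f = qProd t} →
        littleQ j * g ∈ Submodule.span ℂ
        {f | ∃ t : Multiset ℕ, t.sum + m = (a ::ₘ s).sum ∧ f = qProd t} := by
      intro j hj g hg
      induction hg using Submodule.span_induction with
      | mem g hg =>
        obtain ⟨t, ht, rfl⟩ := hg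
        refine Submodule.subset_span ⟨j ::ₘ t, ?_, (qProd_cons _ _).symm⟩
        rw [Multiset.sum_cons, Multiset.sum_cons]
        omega
      | zero => rw [mul_zero]; exact Submodule.zero_mem _
      | add f g _ _ hf hg => rw [mul_add]; exact Submodule.add_mem _ hf hg
      | smul c g _ hg => rw [mul_smul_comm]; exact Submodule.smul_mem _ _ hg
    rcases h : x.1 with _ | k
    · rw [skew_zero]
      exact hmem a (by omega) _ (ih _)
    · rw [← littleQInt_natCast, skew_succ_littleQInt, mul_assoc, two_mul]
      rcases lt_or_ge a (k + 1) with hk | hk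
      · rw [littleQInt_of_neg (by omega)]
        simp
      · have : (a : ℤ) - (k + 1) = (a - (k + 1) : ℕ) := by omega
        rw [this, littleQInt_natCast]
        have := hmem (a - (k + 1)) (by omega) _ (ih _)
        exact Submodule.add_mem _ this this

theorem littleQ_mul_skew_mem {n m k : ℕ} {f : TimeRing} (hf : f ∈ qFilt n 0) :
    littleQ (k + m) * skew qShift m f ∈ qFilt (k + n) (2 ^ (k + m) - 1) := by
  induction hf using Submodule.span_induction with
  | mem g hg =>
    obtain ⟨s, hs, -, rfl⟩ := hg
    generalize hh : skew qShift m (qProd s) = h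
    have hmem := skew_qProd_mem m s
    rw [hh] at hmem
    clear hh
    induction hmem using Submodule.span_induction with
    | mem g hg =>
      obtain ⟨t, ht, rfl⟩ := hg
      rw [← qProd_cons]
      exact qProd_mem_qFilt (by rw [Multiset.sum_cons]; omega) (by rw [qWeight_cons]; omega)
    | zero => rw [mul_zero]; exact Submodule.zero_mem _
    | add f g _ _ hf hg => rw [mul_add]; exact Submodule.add_mem _ hf hg
    | smul c g _ hg => rw [mul_smul_comm]; exact Submodule.smul_mem _ _ hg
  | zero => simp
  | add f g _ _ hf hg => rw [map_add, mul_add]; exact Submodule.add_mem _ hf hg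
  | smul c g _ hg => rw [map_smul, mul_smul_comm]; exact Submodule.smul_mem _ _ hg

theorem qWeight_lt_of_strict {a : ℕ} {l : List ℕ} (hl : (a :: l).Pairwise (· > ·)) :
    qWeight (l : Multiset ℕ) + 1 ≤ 2 ^ a := by
  induction l generalizing a with
  | nil => simpa [qWeight] using Nat.one_le_two_pow
  | cons b l ih =>
    have hab : b < a := List.rel_of_pairwise_cons hl (by simp)
    have h1 := ih hl.of_cons
    have h2 : 2 ^ (b + 1) ≤ 2 ^ a := Nat.pow_le_pow_right (by norm_num) hab
    rw [← Multiset.cons_coe, qWeight_cons]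
    rw [pow_succ] at h2
    omega

theorem mem_qFilt_of_sub_mem {n c d e : ℕ} {f g : TimeRing} (h : f - g ∈ qFilt n c)
    (hg : g ∈ qFilt n d) (hc : e ≤ c) (hd : e ≤ d) : f ∈ qFilt n e := by
  rw [← sub_add_cancel f g]
  exact Submodule.add_mem _ (qFilt_mono hc h) (qFilt_mono hd hg)

theorem vertexQ_sub_mem {l : List ℕ} (hl : l.Pairwise (· > ·)) :
    vertexQ l - qProd l ∈ qFilt l.sum (qWeight l + 1) := by
  induction l with
  | nil => simp [vertexQ, qProd]
  | cons a l ih =>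
    obtain ⟨N, hN⟩ := vertexQ_cons_eq a l
    have h1 := ih hl.of_cons
    have hw := qWeight_lt_of_strict hl
    rw [hN, ← Multiset.cons_coe, qProd_cons, add_sub_right_comm, ← mul_sub, qWeight_cons,
      List.sum_cons, add_assoc (2 ^ a - 1)]
    refine Submodule.add_mem _ (mul_mem_qFilt (littleQ_mem_qFilt a) h1)
      (Submodule.sum_mem _ fun i _ => neg_one_pow_mul_mem _ ?_)
    have h2 : vertexQ l ∈ qFilt l.sum 0 :=
      mem_qFilt_of_sub_mem h1 (qProd_mem_qFilt (Multiset.sum_coe l) le_rfl) (Nat.zero_le _)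
        (Nat.zero_le _)
    refine qFilt_mono ?_ (littleQ_mul_skew_mem h2)
    have h3 : 2 ^ (a + 1) ≤ 2 ^ (a + (i + 1)) := Nat.pow_le_pow_right (by norm_num) (by omega)
    rw [pow_succ] at h3
    omega

/-! ### Leading terms of the Pfaffians -/

theorem two_pow_add_le {a b : ℕ} (hab : a ≠ b) {c : ℕ} (hc : a + b = 2 * c) :
    2 * (2 ^ c - 1) + 1 ≤ (2 ^ a - 1) + (2 ^ b - 1) := by
  wlog h : b < a generalizing a b
  · have := this hab.symm (by omega) (by omega)
    omega
  have h1 : 2 ^ (c + 1) ≤ 2 ^ a := Nat.pow_le_pow_right (by norm_num) (by omega)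
  have h2 : 1 ≤ 2 ^ b := Nat.one_le_two_pow
  have h3 : 1 ≤ 2 ^ c := Nat.one_le_two_pow
  rw [pow_succ] at h1
  omega

theorem twoRowQ_sub_mem {a b : ℕ} (hab : b ≤ a) : twoRowQ a b - littleQ a * littleQ b ∈
    qFilt (a + b) ((2 ^ a - 1) + (2 ^ b - 1) + 1) := by
  rw [twoRowQ, add_sub_cancel_left, two_mul]
  have : ∑ i ∈ Finset.Icc 1 b, (-1) ^ i * (littleQ (a + i) * littleQ (b - i)) ∈
      qFilt (a + b) ((2 ^ a - 1) + (2 ^ b - 1) + 1) := by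
    refine Submodule.sum_mem _ fun i hi => neg_one_pow_mul_mem _ ?_
    rw [Finset.mem_Icc] at hi
    have := mul_mem_qFilt (littleQ_mem_qFilt (a + i)) (littleQ_mem_qFilt (b - i))
    rw [show a + i + (b - i) = a + b by omega] at this
    refine qFilt_mono ?_ this
    have h1 : 2 ^ (a + 1) ≤ 2 ^ (a + i) := Nat.pow_le_pow_right (by norm_num) (by omega)
    have h2 : 1 ≤ 2 ^ (b - i) := Nat.one_le_two_pow
    have h3 : 1 ≤ 2 ^ b := Nat.one_le_two_pow
    have h4 : 2 ^ b ≤ 2 ^ a := Nat.pow_le_pow_right (by norm_num) hab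
    rw [pow_succ] at h1
    omega
  exact Submodule.add_mem _ this this

theorem mul_sub_mul_mem_qFilt {n m c d : ℕ} {x x' y y' : TimeRing}
    (hx : x - x' ∈ qFilt n (c + 1)) (hx' : x' ∈ qFilt n c) (hy : y - y' ∈ qFilt m (d + 1))
    (hy' : y' ∈ qFilt m d) : x * y - x' * y' ∈ qFilt (n + m) (c + d + 1) := by
  have h : x * y - x' * y' = (x - x') * y + x' * (y - y') := by ring
  rw [h]
  refine Submodule.add_mem _ ?_ (by rw [add_assoc]; exact mul_mem_qFilt hx' hy)
  rw [add_right_comm]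
  exact mul_mem_qFilt hx (mem_qFilt_of_sub_mem hy hy' (Nat.le_succ d) le_rfl)

theorem prod_littleQ_mem {k : ℕ} (f : Fin k → ℕ) :
    ∏ i, littleQ (f i) ∈ qFilt (∑ i, f i) (∑ i, (2 ^ f i - 1)) :=
  Submodule.subset_span ⟨Finset.univ.val.map f, rfl, le_of_eq (by simp only [qWeight, Multiset.map_map]; rfl),
    by simp only [qProd, Multiset.map_map]; rfl⟩

/-- The skew-symmetric matrix of the functions `Q_{(f_i, f_j)}`. -/
def twoRowMatrix {k : ℕ} (f : Fin k → ℕ) : Matrix (Fin k) (Fin k) TimeRing :=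
  Matrix.of fun i j => if i < j then twoRowQ (f i) (f j)
    else if j < i then -twoRowQ (f j) (f i) else 0

theorem twoRowMatrix_submatrix {k m : ℕ} (f : Fin k → ℕ) {g : Fin m → Fin k}
    (hg : StrictMono g) : (twoRowMatrix f).submatrix g g = twoRowMatrix (f ∘ g) := by
  ext1 i j
  simp [twoRowMatrix, hg.lt_iff_lt]

theorem pfaffian_twoRowMatrix_sub_mem (m : ℕ) (f : Fin (2 * m) → ℕ) (hf : Antitone f) :
    pfaffian (2 * m) (twoRowMatrix f) - ∏ i, littleQ (f i) ∈
      qFilt (∑ i, f i) (∑ i, (2 ^ f i - 1) + 1) := by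
  induction m with
  | zero =>
    have : pfaffian (2 * 0) (twoRowMatrix f) = 1 := by rfl
    rw [this]
    simp
  | succ m ih =>
    suffices key : ∀ f : Fin (2 * m + 2) → ℕ, Antitone f →
        pfaffian (2 * m + 2) (twoRowMatrix f) - ∏ i, littleQ (f i) ∈
          qFilt (∑ i, f i) (∑ i, (2 ^ f i - 1) + 1) from key f hf
    clear hf f
    intro f hf
    have hone : ∏ i, littleQ (f i) =
        ∑ j : Fin (2 * m + 1), (-1) ^ (j : ℕ) * ∏ i, littleQ (f i) := by
      rw [← Finset.sum_mul, Fin.sum_univ_eq_sum_range (fun j => ((-1) ^ j : TimeRing)),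
        neg_one_geom_sum, if_neg (by simp), one_mul]
    rw [hone, pfaffian, ← Finset.sum_sub_distrib]
    refine Submodule.sum_mem _ fun j _ => ?_
    rw [mul_assoc, ← mul_sub]
    refine neg_one_pow_mul_mem _ ?_
    have hg : StrictMono fun i : Fin (2 * m) => (j.succAbove i).succ := fun x y hxy =>
      Fin.succ_lt_succ_iff.2 (Fin.strictMono_succAbove j hxy)
    rw [twoRowMatrix_submatrix f hg]
    have h0 : twoRowMatrix f 0 j.succ = twoRowQ (f 0) (f j.succ) := by
      simp [twoRowMatrix]
    have e1 : ∏ i, littleQ (f i) = littleQ (f 0) * littleQ (f j.succ) *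
        ∏ i, littleQ (f (j.succAbove i).succ) := by
      rw [Fin.prod_univ_succ, Fin.prod_univ_succAbove _ j, mul_assoc]
    have e2 : ∑ i, f i = f 0 + f j.succ + ∑ i, f (j.succAbove i).succ := by
      rw [Fin.sum_univ_succ, Fin.sum_univ_succAbove _ j, ← add_assoc]
    have e3 : ∑ i, (2 ^ f i - 1) = (2 ^ f 0 - 1) + (2 ^ f j.succ - 1) +
        ∑ i, (2 ^ f (j.succAbove i).succ - 1) := by
      rw [Fin.sum_univ_succ, Fin.sum_univ_succAbove _ j, ← add_assoc]
    rw [h0, e1, e2, e3]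
    exact mul_sub_mul_mem_qFilt (twoRowQ_sub_mem (hf (Fin.zero_le _)))
      (mul_mem_qFilt (littleQ_mem_qFilt _) (littleQ_mem_qFilt _))
      (ih _ fun x y hxy => hf (hg.monotone hxy)) (prod_littleQ_mem _)

@[to_additive]
theorem prod_range_getD {M : Type*} [CommMonoid M] (g : ℕ → M) (hg : g 0 = 1) (l : List ℕ)
    {N : ℕ} (hN : l.length ≤ N) : ∏ i ∈ Finset.range N, g (l.getD i 0) = (l.map g).prod := by
  induction l generalizing N with
  | nil => simp [hg]
  | cons a l ih =>
    obtain ⟨N, rfl⟩ := Nat.exists_eq_add_of_le' (show 1 ≤ N from by simp at hN; omega)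
    rw [Finset.prod_range_succ', List.map_cons, List.prod_cons, mul_comm]
    simp only [List.getD_cons_zero, List.getD_cons_succ]
    rw [ih (by simpa using hN)]

@[to_additive]
theorem prod_part {M : Type*} [CommMonoid M] (g : ℕ → M) (hg : g 0 = 1) (s : Multiset ℕ)
    {N : ℕ} (hN : s.card ≤ N) : ∏ i : Fin N, g (part s i) = (s.map g).prod := by
  rw [Fin.prod_univ_eq_prod_range (fun i => g (part s i))]
  simp only [part]
  rw [prod_range_getD g hg _ (by rwa [card_sortedParts])]
  conv_rhs => rw [← coe_sortedParts s]
  simp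

theorem part_antitone (s : Multiset ℕ) : Antitone (part s) := by
  intro i j hij
  unfold part
  rcases lt_or_ge j (sortedParts s).length with hj | hj
  · rw [List.getD_eq_getElem _ _ hj, List.getD_eq_getElem _ _ (hij.trans_lt hj)]
    rcases hij.eq_or_lt with rfl | h
    · exact le_rfl
    · exact List.pairwise_iff_getElem.1 (sortedParts_pairwise s) i j _ _ h
  · rw [List.getD_eq_default _ _ hj]
    exact Nat.zero_le _

/-- The `Q`-function has leading term the product of the `q_k`. -/
theorem schurQ_sub_mem (s : Multiset ℕ) :
    schurQ s - qProd s ∈ qFilt s.sum (qWeight s + 1) := by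
  obtain ⟨m, hm⟩ : ∃ m, s.card + s.card % 2 = 2 * m := ⟨(s.card + 1) / 2, by omega⟩
  have key : ∀ N, s.card ≤ N → N = 2 * m → pfaffian N (twoRowMatrix fun i : Fin N => part s i) -
      qProd s ∈ qFilt s.sum (qWeight s + 1) := by
    rintro N hN rfl
    have := pfaffian_twoRowMatrix_sub_mem m (fun i => part s i)
      fun x y hxy => part_antitone s hxy
    rwa [prod_part littleQ littleQ_zero s hN, sum_part (fun a => a) rfl s hN,
      sum_part (fun a => 2 ^ a - 1) rfl s hN, Multiset.map_id'] at this
  exact key _ (Nat.le_add_right _ _) hm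

/-! ### Reduction to strict partitions -/

theorem littleQ_mul_self_mem {a : ℕ} (ha : a ≠ 0) :
    littleQ a * littleQ a ∈ qFilt (a + a) (2 * (2 ^ a - 1) + 1) := by
  have h := sum_neg_one_pow_littleQ (n := a + a) (by omega)
  rw [← Finset.add_sum_erase _ _ (a := (a, a)) (by simp), add_eq_zero_iff_eq_neg] at h
  have h2 : littleQ a * littleQ a = (-1) ^ a * ((-1) ^ a * (littleQ a * littleQ a)) := by
    rw [← mul_assoc, ← mul_pow]
    simp
  rw [h2, h]
  refine neg_one_pow_mul_mem _ (Submodule.neg_mem _ (Submodule.sum_mem _ fun x hx =>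
    neg_one_pow_mul_mem _ ?_))
  rw [Finset.mem_erase, Finset.HasAntidiagonal.mem_antidiagonal] at hx
  rw [← hx.2]
  refine qFilt_mono (two_pow_add_le (fun h => hx.1 ?_) (by omega))
    (mul_mem_qFilt (littleQ_mem_qFilt x.1) (littleQ_mem_qFilt x.2))
  ext <;> simp <;> omega

theorem qWeight_lt (s : Multiset ℕ) : qWeight s + 1 ≤ 2 ^ s.sum := by
  induction s using Multiset.induction_on with
  | empty => simp [qWeight]
  | cons a s ih =>
    rw [qWeight_cons, Multiset.sum_cons, pow_add]
    obtain ⟨x, hx⟩ : ∃ x, 2 ^ a = x + 1 := ⟨2 ^ a - 1, by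
      have := Nat.one_le_two_pow (n := a); omega⟩
    rw [hx, Nat.add_sub_cancel]
    nlinarith

theorem qFilt_le_span_strict (n c : ℕ) : qFilt n c ≤ Submodule.span ℂ
    {f | ∃ p : Nat.Partition.distincts n, c ≤ qWeight p.1.parts ∧ f = qProd p.1.parts} := by
  obtain ⟨k, hk⟩ : ∃ k, 2 ^ n ≤ c + k := ⟨2 ^ n, by omega⟩
  induction k generalizing c with
  | zero =>
    rw [qFilt, Submodule.span_le]
    rintro _ ⟨s, rfl, hc, rfl⟩
    have := qWeight_lt s
    omega
  | succ k ih =>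
    rw [qFilt, Submodule.span_le]
    rintro _ ⟨s, hs, hc, rfl⟩
    have h1 : qProd (s.filter (· ≠ 0)) = qProd s := by
      conv_rhs => rw [← Multiset.filter_add_not (· ≠ 0) s, qProd_add]
      have : Multiset.filter (fun a => ¬a ≠ 0) s =
          Multiset.replicate (s.filter fun a => ¬a ≠ 0).card 0 :=
        Multiset.eq_replicate_card.2 fun b hb => by simpa using (Multiset.mem_filter.1 hb).2
      rw [this]
      simp [qProd, littleQ_zero]
    have h2 : qWeight (s.filter (· ≠ 0)) = qWeight s := by
      conv_rhs => rw [← Multiset.filter_add_not (· ≠ 0) s, qWeight_add]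
      have : Multiset.filter (fun a => ¬a ≠ 0) s =
          Multiset.replicate (s.filter fun a => ¬a ≠ 0).card 0 :=
        Multiset.eq_replicate_card.2 fun b hb => by simpa using (Multiset.mem_filter.1 hb).2
      rw [this]
      simp [qWeight]
    have h3 : (s.filter (· ≠ 0)).sum = n := by
      rw [← hs]
      conv_rhs => rw [← Multiset.filter_add_not (· ≠ 0) s, Multiset.sum_add]
      rw [Multiset.sum_eq_zero (s := Multiset.filter (fun a => ¬a ≠ 0) s), add_zero]
      exact fun b hb => by simpa using (Multiset.mem_filter.1 hb).2
    have hpos : ∀ {i}, i ∈ s.filter (· ≠ 0) → 0 < i :=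
      fun hi => Nat.pos_of_ne_zero (Multiset.mem_filter.1 hi).2
    rw [← h1]
    rw [← h2] at hc
    generalize s.filter (· ≠ 0) = t at h3 hpos hc
    by_cases ht : t.Nodup
    · exact Submodule.subset_span ⟨⟨⟨t, hpos, h3⟩, by simpa [Nat.Partition.distincts] using ht⟩,
        hc, rfl⟩
    · rw [Multiset.nodup_iff_ne_cons_cons] at ht
      push Not at ht
      obtain ⟨a, u, rfl⟩ := ht
      have ha : a ≠ 0 := (hpos (Multiset.mem_cons_self _ _)).ne'
      have hmem := mul_mem_qFilt (littleQ_mul_self_mem ha)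
        (qProd_mem_qFilt (s := u) rfl le_rfl)
      rw [mul_assoc, ← qProd_cons, ← qProd_cons] at hmem
      rw [Multiset.sum_cons, Multiset.sum_cons, ← add_assoc] at h3
      rw [qWeight_cons, qWeight_cons] at hc
      rw [h3] at hmem
      refine Submodule.span_mono ?_ (ih (c + 1) (by omega) (qFilt_mono ?_ hmem))
      · rintro f ⟨p, hp, rfl⟩
        exact ⟨p, by omega, rfl⟩
      · omega

/-! ### Gram matrices and unitriangular changes of bases -/

/-- The Gram matrix of a family of functions. -/
def gram {ι : Type*} (c : ℕ+ → ℂ) (F : ι → TimeRing) : Matrix ι ι ℂ :=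
  Matrix.of fun i j => form c (F i) (F j)

theorem gram_eq_mul {ι κ : Type*} [Fintype κ] (c : ℕ+ → ℂ) {F : ι → TimeRing}
    {x : κ → TimeRing} {U : Matrix ι κ ℂ} (h : ∀ i, F i = ∑ j, U i j • x j) :
    gram c F = U * gram c x * U.transpose := by
  ext i j
  simp only [gram, Matrix.of_apply, h, map_sum, LinearMap.sum_apply, map_smul,
    LinearMap.smul_apply, smul_eq_mul, Matrix.mul_apply, Matrix.transpose_apply, Finset.sum_mul]
  refine Finset.sum_congr rfl fun k _ => ?_
  rw [Finset.mul_sum]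
  refine Finset.sum_congr rfl fun l _ => ?_
  ring

theorem exists_det_eq_one {ι : Type*} [Fintype ι] [DecidableEq ι] {F x : ι → TimeRing}
    (w : ι → ℕ) (h : ∀ i, F i - x i ∈ Submodule.span ℂ {f | ∃ j, w i < w j ∧ f = x j}) :
    ∃ U : Matrix ι ι ℂ, U.det = 1 ∧ ∀ i, F i = ∑ j, U i j • x j := by
  have h1 : ∀ i, ∃ a : ι → ℂ, (∀ j, w j ≤ w i → a j = 0) ∧ F i = x i + ∑ j, a j • x j := by
    intro i
    have hle : Submodule.span ℂ {f | ∃ j, w i < w j ∧ f = x j} ≤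
        Submodule.span ℂ (Set.range fun j => if w i < w j then x j else 0) := by
      refine Submodule.span_mono ?_
      rintro _ ⟨j, hj, rfl⟩
      exact ⟨j, if_pos hj⟩
    obtain ⟨a, ha⟩ := (Submodule.mem_span_range_iff_exists_fun ℂ).1 (hle (h i))
    refine ⟨fun j => if w i < w j then a j else 0, fun j hj => if_neg (by omega), ?_⟩
    rw [← sub_eq_iff_eq_add', ← ha]
    refine Finset.sum_congr rfl fun j _ => ?_
    by_cases hj : w i < w j <;> simp [hj]
  choose a ha hF using h1
  refine ⟨1 + Matrix.of a, ?_, fun i => ?_⟩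
  · have ht : (1 + Matrix.of a).BlockTriangular w := by
      intro i j hij
      have : i ≠ j := by rintro rfl; exact hij.false
      simp [this, ha i j hij.le]
    rw [ht.det]
    refine Finset.prod_eq_one fun k _ => ?_
    have : (1 + Matrix.of a).toSquareBlock w k = 1 := by
      ext ⟨i, hi⟩ ⟨j, hj⟩
      simp [Matrix.toSquareBlock_def, Matrix.one_apply, ha i j (hj.trans hi.symm).le]
    rw [this, Matrix.det_one]
  · rw [hF i]
    simp only [Matrix.add_apply, Matrix.of_apply, add_smul, Finset.sum_add_distrib,
      Matrix.one_apply, ite_smul, one_smul, zero_smul, Finset.sum_ite_eq, Finset.mem_univ, if_true]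

theorem det_gram_schurQ (n : ℕ) :
    (gram qParam fun p : Nat.Partition.distincts n => schurQ p.1.parts).det =
      ∏ p : Nat.Partition.distincts n, 2 ^ p.1.parts.card := by
  have hnd : ∀ p : Nat.Partition.distincts n, p.1.parts.Nodup := fun p => by
    simpa [Nat.Partition.distincts] using p.2
  have hstrict : ∀ p : Nat.Partition.distincts n, (sortedParts p.1.parts).Pairwise (· > ·) := by
    intro p
    have h1 := sortedParts_pairwise p.1.parts
    have h2 : (sortedParts p.1.parts).Nodup := by
      rw [← Multiset.coe_nodup, coe_sortedParts]; exact hnd p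
    exact (h1.and h2).imp fun h => lt_of_le_of_ne h.1 (Ne.symm h.2)
  have key : ∀ F : Nat.Partition.distincts n → TimeRing,
      (∀ p, F p - qProd p.1.parts ∈ qFilt n (qWeight p.1.parts + 1)) →
      (gram qParam F).det =
        (gram qParam fun p : Nat.Partition.distincts n => qProd p.1.parts).det := by
    intro F hF
    obtain ⟨U, hU, hFU⟩ := exists_det_eq_one (F := F) (x := fun p => qProd p.1.parts)
      (fun p => qWeight p.1.parts) fun p => qFilt_le_span_strict n _ (hF p)
    rw [gram_eq_mul qParam hFU, Matrix.det_mul, Matrix.det_mul, Matrix.det_transpose, hU]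
    ring
  rw [key _ fun p => by simpa [p.1.parts_sum] using schurQ_sub_mem p.1.parts,
    ← key (fun p => vertexQ (sortedParts p.1.parts)) fun p => by
      have := vertexQ_sub_mem (hstrict p)
      rwa [coe_sortedParts, ← Multiset.sum_coe, coe_sortedParts, p.1.parts_sum] at this]
  have : (gram qParam fun p : Nat.Partition.distincts n => vertexQ (sortedParts p.1.parts)) =
      Matrix.diagonal fun p => 2 ^ p.1.parts.card := by
    ext p r
    have hp : ∀ p : Nat.Partition.distincts n, ∀ i ∈ sortedParts p.1.parts, 0 < i :=
      fun p i hi => p.1.parts_pos (mem_sortedParts.1 hi)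
    rw [gram, Matrix.of_apply, form_vertexQ ⟨hstrict p, hp p⟩ ⟨hstrict r, hp r⟩,
      Matrix.diagonal_apply, card_sortedParts]
    have : sortedParts p.1.parts = sortedParts r.1.parts ↔ p = r :=
      ⟨fun h => Subtype.ext (Nat.Partition.ext (by
        rw [← coe_sortedParts p.1.parts, h, coe_sortedParts])), fun h => by rw [h]⟩
    simp only [this]
  rw [this, Matrix.det_diagonal]

/-! ### Homogeneity -/

/-- Homogeneity of degree `n`, where `t_j` has degree `j`. The degree is an integer, so that the
entries of Jacobi–Trudi matrices have a degree. -/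
abbrev IsHom (f : TimeRing) (n : ℤ) : Prop :=
  IsWeightedHomogeneous (fun j : ℕ+ => ((j : ℕ) : ℤ)) f n

theorem weight_eq_expWeight (m : ℕ+ →₀ ℕ) :
    Finsupp.weight (fun j : ℕ+ => ((j : ℕ) : ℤ)) m = expWeight m := by
  rw [Finsupp.weight_apply, expWeight, Finsupp.sum, Finsupp.sum]
  push_cast
  simp

theorem isHom_timeMonomial {n : ℕ} (ρ : n.Partition) : IsHom (timeMonomial ρ) n := by
  rw [timeMonomial_eq]
  refine isWeightedHomogeneous_monomial _ _ _ ?_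
  rw [weight_eq_expWeight, expWeight_exponent fun _ => ρ.parts_pos, ρ.parts_sum]

theorem isHom_completeHInt (k : ℤ) : IsHom (completeHInt k) k := by
  rcases lt_or_ge k 0 with hk | hk
  · rw [completeHInt_of_neg hk]
    exact isWeightedHomogeneous_zero _ _ _
  · lift k to ℕ using hk
    rw [completeHInt_natCast]
    exact IsWeightedHomogeneous.sum _ _ _ fun ρ _ => isHom_timeMonomial ρ

theorem isHom_littleQ (k : ℕ) : IsHom (littleQ k) k :=
  IsWeightedHomogeneous.sum _ _ _ fun ρ _ => isHom_timeMonomial ρ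

theorem isHom_schurS (s : Multiset ℕ) : IsHom (schurS s) s.sum := by
  rw [schurS, Matrix.det_apply]
  refine IsWeightedHomogeneous.sum _ _ _ fun σ _ => ?_
  have h := IsWeightedHomogeneous.prod Finset.univ
    (fun i : Fin s.card => completeHInt ((part s (σ i) : ℤ) - ((σ i : Fin s.card) : ℕ) + (i : ℕ)))
    _ fun i _ => isHom_completeHInt _
  have hsum : ∑ i : Fin s.card, ((part s (σ i) : ℤ) - ((σ i : Fin s.card) : ℕ) + (i : ℕ)) =
      s.sum := by
    rw [Finset.sum_add_distrib, Finset.sum_sub_distrib,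
      Equiv.sum_comp σ fun i : Fin s.card => (part s i : ℤ),
      Equiv.sum_comp σ fun i : Fin s.card => ((i : ℕ) : ℤ), sub_add_cancel, ← Nat.cast_sum,
      sum_part (fun a => a) rfl s le_rfl, Multiset.map_id']
  rw [hsum] at h
  rcases Int.units_eq_one_or (Equiv.Perm.sign σ) with h1 | h1 <;> rw [h1]
  · rw [one_smul]; exact h
  · rw [Units.neg_smul, one_smul]; exact h.neg

theorem isHom_qProd (s : Multiset ℕ) : IsHom (qProd s) s.sum := by
  induction s using Multiset.induction_on with
  | empty => exact isWeightedHomogeneous_one _ _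
  | cons a s ih =>
    rw [qProd_cons, Multiset.sum_cons, Nat.cast_add]
    exact (isHom_littleQ a).mul ih

theorem schurQ_mem_qFilt (s : Multiset ℕ) : schurQ s ∈ qFilt s.sum 0 :=
  mem_qFilt_of_sub_mem (schurQ_sub_mem s) (qProd_mem_qFilt rfl le_rfl) (Nat.zero_le _)
    (Nat.zero_le _)

theorem isHom_of_mem_qFilt {n c : ℕ} {f : TimeRing} (hf : f ∈ qFilt n c) : IsHom f n := by
  have : qFilt n c ≤ weightedHomogeneousSubmodule ℂ (fun j : ℕ+ => ((j : ℕ) : ℤ)) n := by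
    rw [qFilt, Submodule.span_le]
    rintro _ ⟨s, rfl, -, rfl⟩
    exact isHom_qProd s
  exact this hf

theorem isHom_schurQ (s : Multiset ℕ) : IsHom (schurQ s) s.sum :=
  isHom_of_mem_qFilt (schurQ_mem_qFilt s)

theorem twoReduction_schurQ (s : Multiset ℕ) : twoReduction (schurQ s) = schurQ s := by
  have : qFilt s.sum 0 ≤ LinearMap.eqLocus twoReduction.toLinearMap LinearMap.id := by
    rw [qFilt, Submodule.span_le]
    rintro _ ⟨t, -, -, rfl⟩
    change twoReduction (qProd t) = qProd t
    rw [qProd, map_multiset_prod, Multiset.map_map]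
    simp only [Function.comp_def, twoReduction_littleQ]
  exact this (schurQ_mem_qFilt s)

theorem double_injective : Function.Injective fun j : ℕ+ => 2 * j :=
  fun _ _ h => mul_left_cancel h

theorem isHom_doubleTime {f : TimeRing} {n : ℤ} (hf : IsHom f n) :
    IsHom (doubleTime f) (2 * n) := by
  intro d hd
  obtain ⟨u, rfl, hu⟩ := coeff_rename_ne_zero _ _ _ hd
  rw [← hf hu, weight_eq_expWeight, weight_eq_expWeight, expWeight, expWeight,
    Finsupp.sum_mapDomain_index_inj double_injective, Finsupp.sum, Finsupp.sum]
  push_cast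
  rw [Finset.mul_sum]
  exact Finset.sum_congr rfl fun i _ => by ring

theorem isHom_compoundW (s : Multiset ℕ) :
    IsHom (compoundW s) ((redParts s).sum + 2 * (dblParts s).sum) :=
  (isHom_schurQ _).mul (isHom_doubleTime (isHom_schurS _))

theorem coeff_eq_zero_of_isHom {f : TimeRing} {n : ℤ} (hf : IsHom f n) {m : ℕ+ →₀ ℕ}
    (hm : (expWeight m : ℤ) ≠ n) : coeff m f = 0 := by
  by_contra h
  exact hm ((weight_eq_expWeight m).symm.trans (hf h))

/-- A homogeneous function is determined by its coefficients indexed by partitions. -/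
theorem IsHom.eq_sum {f : TimeRing} {n : ℕ} (hf : IsHom f n) :
    f = ∑ ρ : n.Partition, coeff (exponent ρ.parts) f • monomial (exponent ρ.parts) 1 := by
  ext m
  simp only [coeff_sum, coeff_smul, coeff_monomial, smul_eq_mul, mul_ite, mul_one, mul_zero]
  by_cases h : expWeight m = n
  · obtain ⟨ρ, hρ⟩ := (partitionEquiv n).surjective ⟨m, h⟩
    have hm : exponent ρ.parts = m := congrArg Subtype.val hρ
    rw [Finset.sum_eq_single ρ, if_pos hm, hm]
    · exact fun σ _ hσ => if_neg fun h' => hσ (exponent_injective (h'.trans hm.symm))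
    · simp
  · rw [coeff_eq_zero_of_isHom hf (by exact_mod_cast h)]
    refine (Finset.sum_eq_zero fun ρ _ => if_neg ?_).symm
    rintro rfl
    exact h (partitionEquiv n ρ).2

theorem form_eq_zero_of_isHom (c : ℕ+ → ℂ) {f g : TimeRing} {n m : ℕ} (hf : IsHom f n)
    (hg : IsHom g m) (h : n ≠ m) : form c f g = 0 := by
  rw [hf.eq_sum, map_sum, LinearMap.sum_apply]
  refine Finset.sum_eq_zero fun ρ _ => ?_
  rw [map_smul, LinearMap.smul_apply, form_monomial, coeff_eq_zero_of_isHom hg, mul_zero,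
    smul_zero]
  rw [expWeight_exponent fun _ => ρ.parts_pos, ρ.parts_sum]
  exact_mod_cast h

/-! ### Gram determinants and rescaling of the form -/

theorem gram_monomial {ι : Type*} [DecidableEq ι] (c : ℕ+ → ℂ) {m : ι → ℕ+ →₀ ℕ}
    (hm : Function.Injective m) :
    gram c (fun i => (monomial (m i) 1 : TimeRing)) = Matrix.diagonal fun i => expNorm c (m i) := by
  ext i j
  rw [gram, Matrix.of_apply, form_monomial, coeff_monomial, Matrix.diagonal_apply, one_mul]
  by_cases h : i = j
  · simp [h]
  · rw [if_neg h, if_neg fun h' => h (hm h').symm, mul_zero]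

theorem expNorm_smul (a : ℂ) (c : ℕ+ → ℂ) (m : ℕ+ →₀ ℕ) :
    expNorm (fun j => a * c j) m = a ^ m.degree * expNorm c m := by
  rw [expNorm, expNorm, Finsupp.degree_apply, Finsupp.prod, Finsupp.prod,
    ← Finset.prod_pow_eq_pow_sum, ← Finset.prod_mul_distrib]
  exact Finset.prod_congr rfl fun j _ => by rw [mul_pow]; ring

theorem degree_exponent {s : Multiset ℕ} (hs : ∀ i ∈ s, 0 < i) : (exponent s).degree = s.card := by
  conv_rhs => rw [← expParts_exponent hs, expParts, Multiset.card_map, Finsupp.card_toMultiset]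
  rfl

theorem det_gram_smul {ι : Type*} [Fintype ι] [DecidableEq ι] (a : ℂ) (c : ℕ+ → ℂ)
    {m : ι → ℕ+ →₀ ℕ} (hm : Function.Injective m) {F : ι → TimeRing} {U : Matrix ι ι ℂ}
    (hF : ∀ i, F i = ∑ j, U i j • monomial (m j) 1) :
    (gram (fun j => a * c j) F).det = (∏ i, a ^ (m i).degree) * (gram c F).det := by
  rw [gram_eq_mul _ hF, gram_eq_mul c hF, gram_monomial _ hm, gram_monomial _ hm]
  simp only [Matrix.det_mul, Matrix.det_diagonal, expNorm_smul, Finset.prod_mul_distrib]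
  ring

theorem form_doubleTime (c : ℕ+ → ℂ) (f g : TimeRing) :
    form c (doubleTime f) (doubleTime g) = form (fun j => c (2 * j)) f g := by
  induction f using MvPolynomial.induction_on' with
  | monomial u a =>
    rw [doubleTime, rename_monomial, form_monomial, form_monomial,
      coeff_rename_mapDomain _ double_injective, expNorm, expNorm,
      Finsupp.prod_mapDomain_index_inj double_injective]
  | add p q hp hq => simp only [map_add, LinearMap.add_apply, hp, hq]

theorem gram_schurS (n : ℕ) :
    gram hallParam (fun p : n.Partition => schurS p.parts) = 1 := by
  ext p r
  rw [gram, Matrix.of_apply, form_schurS (fun _ => p.parts_pos) (fun _ => r.parts_pos),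
    Matrix.one_apply]
  simp only [Nat.Partition.ext_iff]

theorem det_gram_doubleTime_schurS (n : ℕ) :
    (gram hallParam fun p : n.Partition => doubleTime (schurS p.parts)).det =
      ∏ p : n.Partition, (1 / 2) ^ p.parts.card := by
  have h : (gram hallParam fun p : n.Partition => doubleTime (schurS p.parts)) =
      gram (fun j => 1 / 2 * hallParam j) fun p : n.Partition => schurS p.parts := by
    ext p r
    rw [gram, gram, Matrix.of_apply, Matrix.of_apply, form_doubleTime]
    congr 3
    funext j
    simp only [hallParam, PNat.mul_coe]
    push_cast
    field_simp
  rw [h, det_gram_smul (1 / 2) hallParam (m := fun p : n.Partition => exponent p.parts)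
    (fun _ _ h => exponent_injective h)
    (U := Matrix.of fun p ρ => coeff (exponent ρ.parts) (schurS p.parts)) fun p => ?_,
    gram_schurS, Matrix.det_one, mul_one]
  · exact Finset.prod_congr rfl fun p _ => by rw [degree_exponent fun _ => p.parts_pos]
  · have := isHom_schurS p.parts
    rw [p.parts_sum] at this
    exact this.eq_sum

/-! ### The Glaisher bijection -/

theorem two_pow_mul_oddPart (a : ℕ) :
    2 ^ padicValNat 2 a * (a / 2 ^ padicValNat 2 a) = a :=
  Nat.mul_div_cancel' pow_padicValNat_dvd

theorem not_even_oddPart {a : ℕ} (ha : a ≠ 0) : ¬Even (a / 2 ^ padicValNat 2 a) := by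
  rw [even_iff_two_dvd]
  intro h
  refine pow_succ_padicValNat_not_dvd (p := 2) ha ?_
  obtain ⟨b, hb⟩ := h
  exact ⟨b, by rw [pow_succ, mul_assoc, ← hb, two_pow_mul_oddPart]⟩

theorem sum_glaisher (s : Multiset ℕ) : (glaisher s).sum = s.sum := by
  rw [glaisher, Multiset.sum_bind]
  simp [two_pow_mul_oddPart]

theorem not_even_of_mem_glaisher {s : Multiset ℕ} (hs : ∀ i ∈ s, 0 < i) {i : ℕ}
    (hi : i ∈ glaisher s) : ¬Even i := by
  obtain ⟨a, ha, h⟩ := Multiset.mem_bind.1 hi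
  rw [Multiset.eq_of_mem_replicate h]
  exact not_even_oddPart (hs a ha).ne'

theorem count_glaisher {s : Multiset ℕ} (hs : s.Nodup) (q : ℕ) : (glaisher s).count q =
    ∑ p ∈ (s.toFinset.filter fun a => a / 2 ^ padicValNat 2 a = q).image (padicValNat 2), 2 ^ p := by
  rw [Finset.sum_image, Finset.sum_filter, glaisher, Multiset.count_bind]
  · simp only [Multiset.count_replicate]
    rw [Finset.sum, Multiset.toFinset_val, hs.dedup]
  · intro a ha b hb hab
    have ha' := (Finset.mem_filter.1 ha).2
    have hb' := (Finset.mem_filter.1 hb).2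
    rw [← two_pow_mul_oddPart a, ← two_pow_mul_oddPart b, ha', hb']
    rw [show padicValNat 2 a = padicValNat 2 b from hab]

theorem glaisher_injective {s t : Multiset ℕ} (hs : s.Nodup) (ht : t.Nodup)
    (h : glaisher s = glaisher t) : s = t := by
  have key : ∀ {s t : Multiset ℕ}, s.Nodup → t.Nodup → glaisher s = glaisher t →
      ∀ a ∈ s, a ∈ t := by
    intro s t hs ht h a ha
    have hc := congrArg (Multiset.count (a / 2 ^ padicValNat 2 a)) h
    rw [count_glaisher hs, count_glaisher ht] at hc
    have heq := Finset.geomSum_injective le_rfl hc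
    have hmem : padicValNat 2 a ∈ (s.toFinset.filter fun b =>
        b / 2 ^ padicValNat 2 b = a / 2 ^ padicValNat 2 a).image (padicValNat 2) :=
      Finset.mem_image_of_mem _ (by simp [ha])
    rw [heq] at hmem
    obtain ⟨b, hb, hba⟩ := Finset.mem_image.1 hmem
    rw [Finset.mem_filter, Multiset.mem_toFinset] at hb
    rw [← two_pow_mul_oddPart a, ← hb.2, ← hba, two_pow_mul_oddPart b]
    exact hb.1
  exact (Multiset.Nodup.ext hs ht).2 fun a => ⟨key hs ht h a, key ht hs h.symm a⟩

theorem nodup_of_distincts {n : ℕ} (p : Nat.Partition.distincts n) : p.1.parts.Nodup := by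
  simpa [Nat.Partition.distincts] using p.2

/-- The partition into odd parts attached to a strict partition. -/
def glaisherPartition {n : ℕ} (p : Nat.Partition.distincts n) : Nat.Partition.odds n :=
  ⟨⟨glaisher p.1.parts, fun {i} hi => Nat.pos_of_ne_zero fun h0 => not_even_of_mem_glaisher
    (fun _ => p.1.parts_pos) hi (by simp [h0]), by rw [sum_glaisher, p.1.parts_sum]⟩, by
    simpa [Nat.Partition.odds, Nat.Partition.restricted] using
      fun i hi => Nat.not_even_iff_odd.1 (not_even_of_mem_glaisher (fun _ => p.1.parts_pos) hi)⟩

theorem glaisherPartition_bijective (n : ℕ) :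
    Function.Bijective (glaisherPartition (n := n)) := by
  rw [Fintype.bijective_iff_injective_and_card]
  refine ⟨fun p r h => ?_, ?_⟩
  · refine Subtype.ext (Nat.Partition.ext
      (glaisher_injective (nodup_of_distincts p) (nodup_of_distincts r) ?_))
    exact congrArg (fun x : Nat.Partition.odds n => x.1.parts) h
  · rw [Fintype.card_coe, Fintype.card_coe, Nat.Partition.card_odds_eq_card_distincts]

/-- The Hall Gram determinant of the `Q`-functions. -/
theorem det_gram_hall_schurQ (n : ℕ) :
    (∏ p : Nat.Partition.distincts n, (2 : ℂ) ^ (glaisher p.1.parts).card) *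
      (gram hallParam fun p : Nat.Partition.distincts n => schurQ p.1.parts).det =
      ∏ p : Nat.Partition.distincts n, 2 ^ p.1.parts.card := by
  set e := Equiv.ofBijective _ (glaisherPartition_bijective n) with he
  have hc : qParam = fun j => 2 * hallParam j := by
    funext j
    simp only [qParam, hallParam]
    ring
  rw [← det_gram_schurQ, hc, det_gram_smul 2 hallParam
    (m := fun p : Nat.Partition.distincts n => exponent (e p).1.parts)
    (fun _ _ h => e.injective (Subtype.ext (exponent_injective h)))
    (U := Matrix.of fun p r => coeff (exponent (e r).1.parts) (schurQ p.1.parts)) fun p => ?_]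
  · congr 1
    refine Finset.prod_congr rfl fun p _ => ?_
    rw [degree_exponent fun _ => (e p).1.parts_pos]
    rfl
  · have h := isHom_schurQ p.1.parts
    rw [p.1.parts_sum] at h
    conv_lhs => rw [h.eq_sum]
    simp only [Matrix.of_apply]
    rw [Equiv.sum_comp e fun r => coeff (exponent r.1.parts) (schurQ p.1.parts) •
      (monomial (exponent r.1.parts) 1 : TimeRing)]
    rw [← Finset.sum_coe_sort (Nat.Partition.odds n) (fun r => coeff (exponent r.parts)
      (schurQ p.1.parts) • (monomial (exponent r.parts) 1 : TimeRing)) |>.symm]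
    refine (Finset.sum_subset (Finset.subset_univ _) fun r _ hr => ?_).symm
    have : ∃ i ∈ r.parts, Even i := by
      simpa [Nat.Partition.odds, Nat.Partition.restricted] using hr
    obtain ⟨i, hi, hev⟩ := this
    lift i to ℕ+ using r.parts_pos hi
    have hd : pderiv i (schurQ p.1.parts) = 0 := by
      rw [← twoReduction_schurQ, pderiv_twoReduction, if_pos hev]
    have hs : exponent r.parts =
        (exponent r.parts - Finsupp.single i 1) + Finsupp.single i 1 := by
      rw [tsub_add_cancel_of_le]
      rw [Finsupp.single_le_iff, exponent_apply]
      exact Multiset.one_le_count_iff_mem.2 hi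
    have hcoef := coeff_pderiv (i := i) (schurQ p.1.parts) (exponent r.parts - Finsupp.single i 1)
    rw [← hs, hd, coeff_zero] at hcoef
    have h0 : (((exponent r.parts - Finsupp.single i 1 : ℕ+ →₀ ℕ) i : ℕ) : ℂ) + 1 ≠ 0 := Nat.cast_add_one_ne_zero _
    rw [(mul_eq_zero.1 hcoef.symm).resolve_right h0, zero_smul]

/-! ### Odd and even variables are orthogonal -/

theorem pderiv_doubleTime {j : ℕ+} (hj : ¬Even (j : ℕ)) (g : TimeRing) :
    pderiv j (doubleTime g) = 0 := by
  induction g using MvPolynomial.induction_on with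
  | C a => simp [doubleTime]
  | add p q hp hq => rw [map_add, map_add, hp, hq, add_zero]
  | mul_X p i hp =>
    have : 2 * i ≠ j := by
      rintro rfl
      exact hj (by simp)
    rw [map_mul, Derivation.leibniz, hp, doubleTime, rename_X, pderiv_X_of_ne this]
    simp

theorem form_doubleTime_mul (c : ℕ+ → ℂ) (f g h : TimeRing) :
    form c (doubleTime g) (twoReduction f * h) =
      constantCoeff f * form c (doubleTime g) h := by
  induction f using MvPolynomial.induction_on generalizing h with
  | C a =>
    rw [twoReduction, aeval_C, algebraMap_eq, ← smul_eq_C_mul, map_smul, constantCoeff_C,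
      smul_eq_mul]
  | add p q hp hq => simp only [map_add, add_mul, hp, hq]
  | mul_X p j hp =>
    rw [map_mul twoReduction, map_mul constantCoeff, twoReduction_X]
    split_ifs with hj
    · simp
    · rw [mul_comm (twoReduction p), mul_assoc, form_mul_X, pderiv_doubleTime hj]
      simp

theorem form_twoReduction_mul_doubleTime (c : ℕ+ → ℂ) (f f' g g' : TimeRing) :
    form c (twoReduction f * doubleTime g) (twoReduction f' * doubleTime g') =
      form c (twoReduction f) (twoReduction f') * form c (doubleTime g) (doubleTime g') := by
  induction f using MvPolynomial.induction_on generalizing f' with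
  | C a =>
    rw [twoReduction, aeval_C, algebraMap_eq, ← smul_eq_C_mul, map_smul, LinearMap.smul_apply,
      ← twoReduction, form_doubleTime_mul, ← mul_one (C a : TimeRing), ← smul_eq_C_mul, map_smul,
      LinearMap.smul_apply, form_one_left, constantCoeff_twoReduction, smul_eq_mul, smul_eq_mul,
      mul_assoc]
  | add p q hp hq => simp only [map_add, add_mul, LinearMap.add_apply, hp, hq]
  | mul_X p j hp =>
    rw [map_mul twoReduction, twoReduction_X]
    split_ifs with hj
    · simp
    · rw [mul_comm (twoReduction p), mul_assoc, form_X_mul, form_X_mul, Derivation.leibniz,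
        pderiv_doubleTime hj, smul_zero, zero_add, smul_eq_mul, pderiv_twoReduction, if_neg hj,
        mul_comm (doubleTime g'), hp, mul_assoc]

/-! ### The decomposition of partitions -/

theorem count_redParts (s : Multiset ℕ) (i : ℕ) : (redParts s).count i = s.count i % 2 := by
  rw [redParts, Multiset.count_sum']
  simp only [Multiset.count_nsmul, Multiset.count_singleton, mul_ite, mul_one, mul_zero]
  rw [Finset.sum_ite_eq]
  split_ifs with h
  · rfl
  · rw [Multiset.count_eq_zero_of_notMem (by simpa using h), Nat.zero_mod]

theorem count_dblParts (s : Multiset ℕ) (i : ℕ) : (dblParts s).count i = s.count i / 2 := by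
  rw [dblParts, Multiset.count_sum']
  simp only [Multiset.count_nsmul, Multiset.count_singleton, mul_ite, mul_one, mul_zero]
  rw [Finset.sum_ite_eq]
  split_ifs with h
  · rfl
  · rw [Multiset.count_eq_zero_of_notMem (by simpa using h), Nat.zero_div]

theorem redParts_add_dblParts (s : Multiset ℕ) : redParts s + (dblParts s + dblParts s) = s := by
  ext i
  rw [Multiset.count_add, Multiset.count_add, count_redParts, count_dblParts]
  omega

theorem sum_redParts_add (s : Multiset ℕ) :
    (redParts s).sum + 2 * (dblParts s).sum = s.sum := by
  conv_rhs => rw [← redParts_add_dblParts s, Multiset.sum_add, Multiset.sum_add]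
  ring

theorem nodup_redParts (s : Multiset ℕ) : (redParts s).Nodup := by
  rw [Multiset.nodup_iff_count_le_one]
  intro i
  rw [count_redParts]
  omega

theorem mem_of_mem_redParts {s : Multiset ℕ} {i : ℕ} (h : i ∈ redParts s) : i ∈ s := by
  rw [← redParts_add_dblParts s]
  exact Multiset.mem_add.2 (Or.inl h)

theorem mem_of_mem_dblParts {s : Multiset ℕ} {i : ℕ} (h : i ∈ dblParts s) : i ∈ s := by
  rw [← redParts_add_dblParts s]
  exact Multiset.mem_add.2 (Or.inr (Multiset.mem_add.2 (Or.inl h)))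

theorem redParts_add {s t : Multiset ℕ} (hs : s.Nodup) : redParts (s + (t + t)) = s := by
  ext i
  have := Multiset.nodup_iff_count_le_one.1 hs i
  rw [count_redParts, Multiset.count_add, Multiset.count_add]
  omega

theorem dblParts_add {s t : Multiset ℕ} (hs : s.Nodup) : dblParts (s + (t + t)) = t := by
  ext i
  have := Multiset.nodup_iff_count_le_one.1 hs i
  rw [count_dblParts, Multiset.count_add, Multiset.count_add]
  omega

theorem redParts_of_nodup {s : Multiset ℕ} (hs : s.Nodup) : redParts s = s := by
  simpa using redParts_add (t := 0) hs

theorem dblParts_of_nodup {s : Multiset ℕ} (hs : s.Nodup) : dblParts s = 0 := by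
  simpa using dblParts_add (t := 0) hs

theorem mem_blockIndex {n n₀ n₁ : ℕ} {p : n.Partition} :
    p ∈ blockIndex n n₀ n₁ ↔ (redParts p.parts).sum = n₀ ∧ (dblParts p.parts).sum = n₁ := by
  simp [blockIndex]

/-- `P_{n₀,n₁}` is the product of the strict partitions of `n₀` and the partitions of `n₁`. -/
def blockEquiv {n n₀ n₁ : ℕ} (h : n₀ + 2 * n₁ = n) :
    blockIndex n n₀ n₁ ≃ Nat.Partition.distincts n₀ × n₁.Partition where
  toFun p := (⟨⟨redParts p.1.parts, fun hi => p.1.parts_pos (mem_of_mem_redParts hi),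
      (mem_blockIndex.1 p.2).1⟩, by simpa [Nat.Partition.distincts] using nodup_redParts _⟩,
    ⟨dblParts p.1.parts, fun hi => p.1.parts_pos (mem_of_mem_dblParts hi),
      (mem_blockIndex.1 p.2).2⟩)
  invFun x := ⟨⟨x.1.1.parts + (x.2.parts + x.2.parts), fun {i} hi => by
      rcases Multiset.mem_add.1 hi with hi | hi
      · exact x.1.1.parts_pos hi
      · exact x.2.parts_pos ((Multiset.mem_add.1 hi).elim id id), by
      rw [Multiset.sum_add, Multiset.sum_add, x.1.1.parts_sum, x.2.parts_sum]; omega⟩, by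
      rw [mem_blockIndex, redParts_add (nodup_of_distincts x.1),
        dblParts_add (nodup_of_distincts x.1), x.1.1.parts_sum, x.2.parts_sum]
      exact ⟨rfl, rfl⟩⟩
  left_inv p := Subtype.ext (Nat.Partition.ext (redParts_add_dblParts _))
  right_inv x := Prod.ext
    (Subtype.ext (Nat.Partition.ext (redParts_add (nodup_of_distincts x.1))))
    (Nat.Partition.ext (dblParts_add (nodup_of_distincts x.1)))

/-! ### The Gram matrix of the compound basis -/

/-- The Hall Gram matrix of the functions `W_λ`. -/
def compoundGram (n : ℕ) : Matrix n.Partition n.Partition ℂ :=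
  gram hallParam fun p : n.Partition => compoundW p.parts

theorem compoundGram_apply {n : ℕ} (p r : n.Partition) : compoundGram n p r =
    form hallParam (schurQ (redParts p.parts)) (schurQ (redParts r.parts)) *
      form hallParam (doubleTime (schurS (dblParts p.parts)))
        (doubleTime (schurS (dblParts r.parts))) := by
  rw [compoundGram, gram, Matrix.of_apply, compoundW, compoundW,
    ← twoReduction_schurQ (redParts p.parts), ← twoReduction_schurQ (redParts r.parts),
    form_twoReduction_mul_doubleTime]

theorem compoundGram_eq_zero {n : ℕ} {p r : n.Partition}
    (h : (dblParts p.parts).sum ≠ (dblParts r.parts).sum) : compoundGram n p r = 0 := by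
  rw [compoundGram_apply, form_eq_zero_of_isHom _ (isHom_schurQ _) (isHom_schurQ _), zero_mul]
  have hp := sum_redParts_add p.parts
  have hr := sum_redParts_add r.parts
  rw [p.parts_sum] at hp
  rw [r.parts_sum] at hr
  omega

theorem det_gram_doubleTime_schurS_mul (n : ℕ) :
    (∏ p : n.Partition, (2 : ℂ) ^ p.parts.card) *
      (gram hallParam fun p : n.Partition => doubleTime (schurS p.parts)).det = 1 := by
  rw [det_gram_doubleTime_schurS, ← Finset.prod_mul_distrib]
  refine Finset.prod_eq_one fun p _ => ?_
  rw [← mul_pow]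
  norm_num

theorem det_compoundGram_block {n n₀ n₁ : ℕ} (h : n₀ + 2 * n₁ = n) :
    ((compoundGram n).submatrix (Subtype.val : blockIndex n n₀ n₁ → _) Subtype.val).det *
      2 ^ (∑ p ∈ blockIndex n n₀ n₁, (((glaisher (redParts p.parts)).card : ℤ) +
        ((dblParts p.parts).card : ℤ) - ((redParts p.parts).card : ℤ))) = 1 := by
  set GQ := gram hallParam fun p : Nat.Partition.distincts n₀ => schurQ p.1.parts with hGQ
  set GS := gram hallParam fun p : n₁.Partition => doubleTime (schurS p.parts) with hGS
  have hsub : (compoundGram n).submatrix (Subtype.val : blockIndex n n₀ n₁ → _) Subtype.val =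
      (Matrix.kroneckerMap (· * ·) GQ GS).submatrix (blockEquiv h) (blockEquiv h) := by
    ext p r
    rw [Matrix.submatrix_apply, compoundGram_apply]
    rfl
  have hexp : (2 : ℂ) ^ (∑ p ∈ blockIndex n n₀ n₁, (((glaisher (redParts p.parts)).card : ℤ) +
        ((dblParts p.parts).card : ℤ) - ((redParts p.parts).card : ℤ))) =
      ∏ x : Nat.Partition.distincts n₀ × n₁.Partition,
        ((2 : ℂ) ^ (glaisher x.1.1.parts).card * 2 ^ x.2.parts.card / 2 ^ x.1.1.parts.card) := by
    rw [← Finset.sum_coe_sort, ← Equiv.prod_comp (blockEquiv h)]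
    have (t : Finset (blockIndex n n₀ n₁)) (f : blockIndex n n₀ n₁ → ℤ) :
        (2 : ℂ) ^ (∑ p ∈ t, f p) = ∏ p ∈ t, (2 : ℂ) ^ f p := by
      induction t using Finset.induction_on with
      | empty => simp
      | insert a t ha ih =>
        rw [Finset.sum_insert ha, Finset.prod_insert ha, zpow_add₀ two_ne_zero, ih]
    rw [this]
    refine Finset.prod_congr rfl fun p _ => ?_
    rw [zpow_sub₀ two_ne_zero, zpow_add₀ two_ne_zero, zpow_natCast, zpow_natCast, zpow_natCast]
    rfl
  rw [hsub, Matrix.det_submatrix_equiv_self, Matrix.det_kronecker, hexp, Fintype.prod_prod_type]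
  simp only [Finset.prod_div_distrib, Finset.prod_mul_distrib, Finset.prod_const, Finset.card_univ,
    Finset.prod_pow]
  have h1 := det_gram_hall_schurQ n₀
  have h2 := det_gram_doubleTime_schurS_mul n₁
  rw [← hGQ] at h1
  rw [← hGS] at h2
  have h3 : (∏ p : Nat.Partition.distincts n₀, (2 : ℂ) ^ p.1.parts.card) ≠ 0 :=
    Finset.prod_ne_zero_iff.2 fun _ _ => pow_ne_zero _ two_ne_zero
  rw [mul_div_assoc', div_eq_one_iff_eq (pow_ne_zero _ h3), ← h1, mul_pow]
  calc _ = (∏ p : Nat.Partition.distincts n₀, (2 : ℂ) ^ (glaisher p.1.parts).card) ^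
        Fintype.card n₁.Partition * GQ.det ^ Fintype.card n₁.Partition *
        ((∏ p : n₁.Partition, (2 : ℂ) ^ p.parts.card) * GS.det) ^
          Fintype.card (Nat.Partition.distincts n₀) := by
        rw [mul_pow]; ring
    _ = _ := by rw [h2, one_pow, mul_one]

theorem compoundGram_blockTriangular (n : ℕ) :
    (compoundGram n).BlockTriangular fun p => (dblParts p.parts).sum :=
  fun _ _ h => compoundGram_eq_zero h.ne'

theorem det_compoundGram_ne_zero (n : ℕ) : (compoundGram n).det ≠ 0 := by
  rw [(compoundGram_blockTriangular n).det, Finset.prod_ne_zero_iff]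
  intro k hk
  obtain ⟨p, -, hp⟩ := Finset.mem_image.1 hk
  have hn : n - 2 * k + 2 * k = n := by
    have := sum_redParts_add p.parts
    rw [p.parts_sum] at this
    omega
  have hiff : ∀ r : n.Partition, (dblParts r.parts).sum = k ↔ r ∈ blockIndex n (n - 2 * k) k := by
    intro r
    have := sum_redParts_add r.parts
    rw [r.parts_sum] at this
    rw [mem_blockIndex]
    omega
  have h := left_ne_zero_of_mul_eq_one (det_compoundGram_block hn)
  rw [← Matrix.det_submatrix_equiv_self (Equiv.subtypeEquivRight hiff)] at h
  exact h

/-! ### The transition matrices -/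

theorem isHom_compoundW_parts {n : ℕ} (p : n.Partition) : IsHom (compoundW p.parts) n := by
  have := isHom_compoundW p.parts
  rwa [← Nat.cast_ofNat, ← Nat.cast_mul, ← Nat.cast_add, sum_redParts_add, p.parts_sum] at this

theorem isHom_schurS_parts {n : ℕ} (p : n.Partition) : IsHom (schurS p.parts) n := by
  have := isHom_schurS p.parts
  rwa [p.parts_sum] at this

/-- The functions `W_λ` span the homogeneous functions. -/
theorem exists_eq_sum_compoundW {n : ℕ} {f : TimeRing} (hf : IsHom f n) :
    ∃ a : n.Partition → ℂ, f = ∑ r, a r • compoundW r.parts := by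
  set M : Matrix n.Partition n.Partition ℂ :=
    Matrix.of fun p ρ => coeff (exponent ρ.parts) (compoundW p.parts) with hM
  have hW : ∀ p : n.Partition, compoundW p.parts =
      ∑ ρ : n.Partition, M p ρ • (monomial (exponent ρ.parts) 1 : TimeRing) :=
    fun p => (isHom_compoundW_parts p).eq_sum
  have hdet := det_compoundGram_ne_zero n
  rw [compoundGram, gram_eq_mul hallParam hW, Matrix.det_mul, Matrix.det_mul] at hdet
  have hMdet : IsUnit M.det := (left_ne_zero_of_mul (left_ne_zero_of_mul hdet)).isUnit
  refine ⟨Matrix.vecMul (fun ρ => coeff (exponent ρ.parts) f) M⁻¹, ?_⟩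
  conv_lhs => rw [hf.eq_sum]
  simp only [hW, Finset.smul_sum, smul_smul]
  rw [Finset.sum_comm]
  refine Finset.sum_congr rfl fun ρ _ => ?_
  rw [← Finset.sum_smul]
  congr 1
  have : Matrix.vecMul (Matrix.vecMul (fun ρ : n.Partition => coeff (exponent ρ.parts) f) M⁻¹) M =
      fun ρ => coeff (exponent ρ.parts) f := by
    rw [Matrix.vecMul_vecMul, Matrix.nonsing_inv_mul _ hMdet, Matrix.vecMul_one]
  exact (congrFun this ρ).symm

theorem exists_isTransitionMatrix (n : ℕ) : ∃ A, IsTransitionMatrix n A := by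
  choose A hA using fun p : n.Partition => exists_eq_sum_compoundW (isHom_schurS_parts p)
  exact ⟨Matrix.of A, hA⟩

/-- Coefficients with respect to a family with invertible Gram matrix are unique. -/
theorem eq_of_sum_smul_eq {ι κ : Type*} [Fintype κ] [DecidableEq κ] {c : ℕ+ → ℂ}
    {x : κ → TimeRing} (hx : (gram c x).det ≠ 0) {U V : Matrix ι κ ℂ}
    (h : ∀ i, ∑ j, U i j • x j = ∑ j, V i j • x j) : U = V := by
  have hmul : U * gram c x = V * gram c x := by
    ext i k
    have := congrArg (fun f => form c f (x k)) (h i)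
    simpa [map_sum, Matrix.mul_apply, gram] using this
  have := congrArg (· * (gram c x)⁻¹) hmul
  simpa [Matrix.mul_assoc, Matrix.mul_nonsing_inv _ hx.isUnit] using this

theorem IsTransitionMatrix.unique {n : ℕ} {A A' : Matrix n.Partition n.Partition ℂ}
    (h : IsTransitionMatrix n A) (h' : IsTransitionMatrix n A') : A = A' :=
  eq_of_sum_smul_eq (det_compoundGram_ne_zero n) fun p => (h p).symm.trans (h' p)

/-- `ᵗA A` is the inverse of the Gram matrix of the `W_λ`. -/
theorem IsTransitionMatrix.compoundGram_mul {n : ℕ} {A : Matrix n.Partition n.Partition ℂ}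
    (h : IsTransitionMatrix n A) : compoundGram n * (A.transpose * A) = 1 := by
  have h1 := gram_eq_mul hallParam h
  rw [gram_schurS, Matrix.mul_assoc] at h1
  rw [← Matrix.mul_assoc]
  exact mul_eq_one_comm.1 h1.symm

theorem IsTransitionMatrix.apply_eq_zero {n : ℕ} {A : Matrix n.Partition n.Partition ℂ}
    (h : IsTransitionMatrix n A) {p r : n.Partition}
    (hpr : (dblParts p.parts).sum ≠ (dblParts r.parts).sum) : (A.transpose * A) p r = 0 := by
  have hinv := Matrix.inv_eq_right_inv h.compoundGram_mul
  have := Matrix.invertibleOfIsUnitDet _ (det_compoundGram_ne_zero n).isUnit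
  have hbt := Matrix.blockTriangular_inv_of_blockTriangular (compoundGram_blockTriangular n)
  rw [hinv] at hbt
  rcases hpr.lt_or_gt with hlt | hlt
  · have hsymm : (A.transpose * A).transpose = A.transpose * A := by
      rw [Matrix.transpose_mul, Matrix.transpose_transpose]
    rw [← hsymm]
    exact hbt hlt
  · exact hbt hlt

theorem IsTransitionMatrix.det_block {n : ℕ} {A : Matrix n.Partition n.Partition ℂ}
    (h : IsTransitionMatrix n A) {n₀ n₁ : ℕ} (hn : n₀ + 2 * n₁ = n) :
    (block A n₀ n₁).det = 2 ^ (∑ p ∈ blockIndex n n₀ n₁,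
      (((glaisher (redParts p.parts)).card : ℤ) + ((dblParts p.parts).card : ℤ) -
        ((redParts p.parts).card : ℤ))) := by
  have hmul : (compoundGram n).submatrix (Subtype.val : blockIndex n n₀ n₁ → _) Subtype.val *
      block A n₀ n₁ = 1 := by
    ext p r
    have hpr := congrFun (congrFun h.compoundGram_mul p.1) r.1
    rw [Matrix.mul_apply] at hpr ⊢
    simp only [Matrix.submatrix_apply, block]
    rw [Finset.sum_coe_sort (blockIndex n n₀ n₁)
      (fun s => compoundGram n p.1 s * (A.transpose * A) s r.1),
      Finset.sum_subset (Finset.subset_univ _) fun s _ hs => ?_, hpr]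
    · simp only [Matrix.one_apply, Subtype.val_inj]
    · rw [compoundGram_eq_zero, zero_mul]
      have h1 := mem_blockIndex.1 p.2
      have h2 := sum_redParts_add s.parts
      rw [mem_blockIndex] at hs
      rw [s.parts_sum] at h2
      omega
  have hd := congrArg Matrix.det hmul
  rw [Matrix.det_mul, Matrix.det_one] at hd
  have hK := det_compoundGram_block hn
  exact mul_left_cancel₀ (left_ne_zero_of_mul_eq_one hd) (hd.trans hK.symm)

/-! ### The Stembridge coefficients -/

theorem twoReduction_doubleTime (f : TimeRing) :
    twoReduction (doubleTime f) = C (constantCoeff f) := by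
  induction f using MvPolynomial.induction_on with
  | C a => simp [twoReduction, doubleTime]
  | add p q hp hq => simp [hp, hq]
  | mul_X p j hp => simp [doubleTime, twoReduction_X]

theorem schurS_zero : schurS 0 = 1 := Matrix.det_fin_zero

theorem twoReduction_compoundW_of_mem {n : ℕ} {p : n.Partition}
    (hp : p ∈ Nat.Partition.distincts n) : twoReduction (compoundW p.parts) = schurQ p.parts := by
  have hnd := nodup_of_distincts ⟨p, hp⟩
  rw [compoundW, redParts_of_nodup hnd, dblParts_of_nodup hnd, schurS_zero, map_one, mul_one,
    twoReduction_schurQ]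

theorem twoReduction_compoundW_of_notMem {n : ℕ} {p : n.Partition}
    (hp : p ∉ Nat.Partition.distincts n) : twoReduction (compoundW p.parts) = 0 := by
  have hd : (dblParts p.parts).sum ≠ 0 := by
    intro h
    rw [← blockIndex_principal, mem_blockIndex] at hp
    have := sum_redParts_add p.parts
    rw [p.parts_sum] at this
    omega
  rw [compoundW, map_mul, twoReduction_doubleTime, constantCoeff_eq,
    coeff_eq_zero_of_isHom (isHom_schurS _), map_zero, mul_zero]
  have h0 : expWeight 0 = 0 := by simp [expWeight]
  rw [h0]
  exact_mod_cast hd.symm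

/-- The strict columns of `A_n` form the matrix `Γ_n`. -/
theorem IsTransitionMatrix.isStembridgeMatrix {n : ℕ} {A : Matrix n.Partition n.Partition ℂ}
    (h : IsTransitionMatrix n A) : IsStembridgeMatrix n (A.submatrix id Subtype.val) := by
  intro p
  rw [h p, map_sum]
  simp only [map_smul, Matrix.submatrix_apply, id]
  rw [Finset.sum_coe_sort (Nat.Partition.distincts n) fun r => A p r • schurQ r.parts]
  rw [← Finset.sum_subset (Finset.subset_univ (Nat.Partition.distincts n)) fun r _ hr => by
    rw [twoReduction_compoundW_of_notMem hr, smul_zero]]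
  exact Finset.sum_congr rfl fun r hr => by rw [twoReduction_compoundW_of_mem hr]

theorem IsStembridgeMatrix.unique {n : ℕ} {Γ Γ' : Matrix n.Partition (Nat.Partition.distincts n) ℂ}
    (h : IsStembridgeMatrix n Γ) (h' : IsStembridgeMatrix n Γ') : Γ = Γ' := by
  refine eq_of_sum_smul_eq (c := qParam)
    (x := fun r : Nat.Partition.distincts n => schurQ r.1.parts) ?_ fun p =>
    (h p).symm.trans (h' p)
  rw [det_gram_schurQ]
  exact Finset.prod_ne_zero_iff.2 fun _ _ => pow_ne_zero _ two_ne_zero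

end CompoundBasis

end

theorem theorem4p8 (n : ℕ) :
    -- the defining relations determine the matrices `A_n` and `Γ_n`
    (∃! A : Matrix n.Partition n.Partition ℂ, IsTransitionMatrix n A) ∧
    (∃! Γ : Matrix n.Partition (Nat.Partition.distincts n) ℂ, IsStembridgeMatrix n Γ) ∧
    -- the index sets `P_{n₀,n₁}` with `n₀ + 2 n₁ = n` partition the set of partitions of `n`
    (∀ p : n.Partition, ∃! m : ℕ × ℕ, m.1 + 2 * m.2 = n ∧ p ∈ blockIndex n m.1 m.2) ∧
    ∀ (A : Matrix n.Partition n.Partition ℂ)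
      (Γ : Matrix n.Partition (Nat.Partition.distincts n) ℂ),
      IsTransitionMatrix n A → IsStembridgeMatrix n Γ →
      -- `ᵗA A` is block diagonal
      (∀ n₀ n₁ m₀ m₁ : ℕ, (n₀, n₁) ≠ (m₀, m₁) →
        ∀ p ∈ blockIndex n n₀ n₁, ∀ r ∈ blockIndex n m₀ m₁, (A.transpose * A) p r = 0) ∧
      -- the determinants of the blocks
      (∀ n₀ n₁ : ℕ, n₀ + 2 * n₁ = n →
        ‖(block A n₀ n₁).det‖ = (2 : ℝ) ^ (∑ p ∈ blockIndex n n₀ n₁,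
          (((glaisher (redParts p.parts)).card : ℤ) + ((dblParts p.parts).card : ℤ)
            - ((redParts p.parts).card : ℤ)))) ∧
      -- the principal block is `G_n = ᵗΓ Γ`, and its determinant
      block A n 0 = (Γ.transpose * Γ).submatrix (principalEquiv n) (principalEquiv n) ∧
      (Γ.transpose * Γ).det = (2 : ℂ) ^ (∑ p ∈ Nat.Partition.distincts n,
        (((glaisher p.parts).card : ℤ) - (p.parts.card : ℤ))) := by
  obtain ⟨A₀, hA₀⟩ := exists_isTransitionMatrix n
  refine ⟨⟨A₀, hA₀, fun A hA => hA.unique hA₀⟩,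
    ⟨_, hA₀.isStembridgeMatrix, fun Γ hΓ => hΓ.unique hA₀.isStembridgeMatrix⟩,
    fun p => ?_, fun A Γ hA hΓ => ?_⟩
  · refine ⟨((redParts p.parts).sum, (dblParts p.parts).sum),
      ⟨(sum_redParts_add _).trans p.parts_sum, mem_blockIndex.2 ⟨rfl, rfl⟩⟩, ?_⟩
    rintro ⟨m₀, m₁⟩ ⟨-, hm⟩
    rw [mem_blockIndex] at hm
    exact Prod.ext hm.1.symm hm.2.symm
  · have hΓA := hΓ.unique hA.isStembridgeMatrix
    have hblock : block A n 0 =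
        (Γ.transpose * Γ).submatrix (principalEquiv n) (principalEquiv n) := by
      rw [hΓA]
      rfl
    refine ⟨fun n₀ n₁ m₀ m₁ hne p hp r hr => hA.apply_eq_zero fun h => hne ?_,
      fun n₀ n₁ hn => ?_, hblock, ?_⟩
    · have h1 := sum_redParts_add p.parts
      have h2 := sum_redParts_add r.parts
      rw [p.parts_sum] at h1
      rw [r.parts_sum] at h2
      rw [mem_blockIndex] at hp hr
      ext <;> simp only <;> omega
    · rw [hA.det_block hn, norm_zpow, Complex.norm_ofNat]
    · have hdet := hA.det_block (n₀ := n) (n₁ := 0) (by omega)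
      rw [hblock, Matrix.det_submatrix_equiv_self, blockIndex_principal] at hdet
      rw [hdet]
      congr 1
      refine Finset.sum_congr rfl fun p hp => ?_
      have hnd := nodup_of_distincts ⟨p, hp⟩
      rw [redParts_of_nodup hnd, dblParts_of_nodup hnd]
      simp
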